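/- **Conventions.** Let $\mathcal S$ be the standard skeleton of the category of finite sets: objects are the natural numbers $n$ (standing for the ordered set $\{0,\dots,n-1\}$), morphisms are functions. For $f\colon m\to n$ and $j\in n$ let $f^{-1}j$ be the cardinality of the actual fibre, identified with it by the increasing enumeration; this gives functors $R_n\colon\mathcal S/n\to\mathcal S^{n}$. An *operadic category* is a small category $\mathcal C$ with a functor $|\cdot|\colon\mathcal C\to\mathcal S$ and, for each object $c$, a functor $R_c\colon\mathcal C/c\to\mathcal C^{|c|}$ whose composite with $|\cdot|^{|c|}$ equals the composite of $\mathcal C/c\to\mathcal S/|c|$ with $R_{|c|}$. Write $\psi^{-1}j$ for the $j$-th component of $R_d(\psi\colon c\to d)$, and, for $\varphi\colon b\to c$, $\varphi^\psi\colon R_d(\psi\varphi)\to R_d(\psi)$ for the image of $\varphi\colon\psi\varphi\to\psi$ under $R_d$. An object $u$ is *trivial* if $|u|=1$ and $R_u$ is the domain functor. It is required that every $1_c^{-1}i$ is trivial, and that (double slice condition) for every $\psi\colon c\to d$ the functor $(\mathcal C/d)/\psi\to\prod_{j\in|d|}\mathcal C/\psi^{-1}j\to\prod_{j\in|d|}\mathcal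 C^{|\psi^{-1}j|}$ induced by $R_d$ and the $R_{\psi^{-1}j}$ equals $(\mathcal C/d)/\psi\to\mathcal C/c\xrightarrow{R_c}\mathcal C^{|c|}$, where $|\psi^{-1}j|=|\psi|^{-1}j$ and $|c|\cong\sum_j|\psi|^{-1}j$ canonically. A *strict operadic functor* is a functor strictly commuting with the functors $|\cdot|$ and $R$. These form a category $\mathbf{OpCat}$, with terminal object $\mathcal S$. A *skew monoidal category* is a category $\mathcal E$ with a functor $*\colon\mathcal E\times\mathcal E\to\mathcal E$, an object $U$, and natural maps $\alpha\colon(X*Y)*Z\to X*(Y*Z)$, $\lambda\colon U*X\to X$, $\rho\colon X\to X*U$, not necessarily invertible, satisfying the pentagon and the $(\lambda,\rho)$-, $(\alpha,\lambda)$-, $(\alpha,\rho)$- and $(\lambda,\alpha,\rho)$-compatibility axioms. An *opmonoidal functor* is a functor $P$ with a natural transformation $P^2\colon P(X*Y)\to PX*PY$ and a morphism from $P$ of the unit to the unit, compatible with $\alpha$, $\lambda$, $\rho$. These form a category $\mathbf{SkewMonCat}$, in which equality of morphisms is strict. For an operadic category $\mathcal C$ with object set $C$, $\mathrm{Coll}_{\mathcal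 C}$ is the skew monoidal category with underlying category $\mathbf{Set}/C$, tensor $$(X*Y)_c=\sum_{\varphi\colon c\to d}X_d\times\prod_{i\in|d|}Y_{\varphi^{-1}i},$$ unit the set of trivial objects, and $\alpha(x,\psi,y,\varphi,z)=(x,\psi\varphi,y,\varphi^\psi,z)$, $\lambda(u,\varphi,x)=x$, $\rho(x)=(x,1_{\partial x},R1_{\partial x})$, where $\partial$ is the structure map to $C$. A strict operadic functor $F\colon\mathcal C\to\mathcal D$ with object part $f$ induces the opmonoidal functor $f_!\colon\mathbf{Set}/C\to\mathbf{Set}/D$ (composition with $f$) with $F^2(x,\varphi,y)=(x,F\varphi,y)$. This defines a functor $\mathrm{Coll}\colon\mathbf{OpCat}\to\mathbf{SkewMonCat}$, and hence, since $\mathcal S$ is terminal, a functor $\mathrm{Coll}/1\colon\mathbf{OpCat}\to\mathbf{SkewMonCat}/\mathrm{Coll}_{\mathcal S}$ sending $\mathcal C$ to $\mathrm{Coll}$ of the unique strict operadic functor $\mathcal C\to\mathcal S$. **Theorem 7.1.** The functor $\mathrm{Coll}/1\colon\mathbf{OpCat}\to\mathbf{SkewMonCat}/\mathrm{Coll}_{\mathcal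 S}$ is fully faithful. An opmonoidal functor $P\colon\mathcal E\to\mathrm{Coll}_{\mathcal S}$ is in the image of $\mathrm{Coll}/1$, i.e. isomorphic in $\mathbf{SkewMonCat}/\mathrm{Coll}_{\mathcal S}$ to an object of the form $(\mathrm{Coll}/1)(\mathcal C)$, if and only if there are a set $C$ and a function $p\colon C\to\mathbb N$ such that - (a) the underlying category of $\mathcal E$ is, up to an isomorphism of categories, the slice category $\mathbf{Set}/C$; - (b) under this isomorphism the underlying functor of $P$ is (strictly equal to) $p_!\colon\mathbf{Set}/C\to\mathbf{Set}/\mathbb N$; - (c) the natural transformation $P^2$ is cartesian, that is, all its naturality squares are pullbacks. Consequently $\mathrm{Coll}/1$ restricts to an equivalence from $\mathbf{OpCat}$ to the full subcategory of $\mathbf{SkewMonCat}/\mathrm{Coll}_{\mathcal S}$ on the objects satisfying (a), (b), (c). -/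

import Mathlib

open CategoryTheory

universe v w u

attribute [local instance 2000] CategoryStruct.toQuiver

namespace OpCats

/-! ### The skeletal category of finite sets, with its chosen fibre functors -/

/-- The standard skeleton `𝒮` of the category of finite sets: the objects are the natural numbers,
a morphism `m ⟶ n` is a function from the standard `m`-element set to the standard `n`-element
set. -/
abbrev FinS : Type u := FintypeCat.Skeleton.{u}

/-- The set with `n` elements which an object `n` of `𝒮` stands for. -/
abbrev Idx (X : FinS.{u}) : Type u := ULift.{u} (Fin X.len)

/-- The identification of the elements of equal objects of `𝒮`. -/
def Idx.cast {X Y : FinS.{u}} (h : X = Y) (i : Idx X) : Idx Y :=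
  ⟨Fin.cast (congrArg FintypeCat.Skeleton.len h) i.down⟩

/-- A morphism of `𝒮` as a function. -/
def FinS.app {X Y : FinS.{u}} (f : X ⟶ Y) : Idx X → Idx Y := f

/-- A function as a morphism of `𝒮`. -/
def FinS.ofFun {X Y : FinS.{u}} (f : Idx X → Idx Y) : X ⟶ Y := f

/-- The actual fibre `{k | f k = j}` of a function. -/
def FinS.preim {X Y : FinS.{u}} (f : X ⟶ Y) (j : Idx Y) : Finset (Fin X.len) :=
  Finset.univ.filter fun k => FinS.app f ⟨k⟩ = j

/-- The fibre `f⁻¹ j` as an object of `𝒮`: the cardinality of the actual fibre. -/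
def FinS.fib {X Y : FinS.{u}} (f : X ⟶ Y) (j : Idx Y) : FinS.{u} :=
  FintypeCat.Skeleton.mk (FinS.preim f j).card

/-- The inclusion of the fibre `f⁻¹ j` in the domain of `f`: the increasing enumeration of the
actual fibre. -/
noncomputable def FinS.incl {X Y : FinS.{u}} (f : X ⟶ Y) (j : Idx Y) (i : Idx (FinS.fib f j)) :
    Idx X :=
  ⟨(FinS.preim f j).orderEmbOfFin rfl i.down⟩

theorem FinS.app_incl {X Y : FinS.{u}} (f : X ⟶ Y) (j : Idx Y) (i : Idx (FinS.fib f j)) :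
    FinS.app f (FinS.incl f j i) = j :=
  (Finset.mem_filter.1 ((FinS.preim f j).orderEmbOfFin_mem rfl i.down)).2

/-- The element of the fibre `f⁻¹ j` given by an element `k` of the domain with `f k = j`. -/
noncomputable def FinS.lift {X Y : FinS.{u}} (f : X ⟶ Y) (j : Idx Y) (k : Idx X)
    (h : FinS.app f k = j) : Idx (FinS.fib f j) :=
  ⟨((FinS.preim f j).orderIsoOfFin rfl).symm
    ⟨k.down, Finset.mem_filter.2 ⟨Finset.mem_univ _, h⟩⟩⟩

theorem FinS.incl_lift {X Y : FinS.{u}} (f : X ⟶ Y) (j : Idx Y) (k : Idx X)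
    (h : FinS.app f k = j) : FinS.incl f j (FinS.lift f j k h) = k := by
  refine ULift.ext _ _ ?_
  refine ((FinS.preim f j).coe_orderIsoOfFin_apply rfl _).symm.trans ?_
  exact congrArg Subtype.val (((FinS.preim f j).orderIsoOfFin rfl).apply_symm_apply _)

theorem FinS.incl_injective {X Y : FinS.{u}} (f : X ⟶ Y) (j : Idx Y) :
    Function.Injective (FinS.incl f j) := by
  intro a b h
  exact ULift.ext _ _ (((FinS.preim f j).orderEmbOfFin rfl).injective (congrArg ULift.down h))

/-- The function induced on the fibres over `j` by a function over `Z`. -/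
noncomputable def FinS.fibMap {X Y Z : FinS.{u}} (f : X ⟶ Z) (f' : Y ⟶ Z) (g : X ⟶ Y)
    (h : g ≫ f' = f) (j : Idx Z) : FinS.fib f j ⟶ FinS.fib f' j :=
  FinS.ofFun fun i => FinS.lift f' j (FinS.app g (FinS.incl f j i))
    ((congrFun h (FinS.incl f j i)).trans (FinS.app_incl f j i))

theorem FinS.incl_fibMap {X Y Z : FinS.{u}} (f : X ⟶ Z) (f' : Y ⟶ Z) (g : X ⟶ Y)
    (h : g ≫ f' = f) (j : Idx Z) (i : Idx (FinS.fib f j)) :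
    FinS.incl f' j (FinS.app (FinS.fibMap f f' g h j) i) = FinS.app g (FinS.incl f j i) :=
  FinS.incl_lift f' j _ ((congrFun h (FinS.incl f j i)).trans (FinS.app_incl f j i))

/-- The functor `R_d : 𝒮/d ⥤ 𝒮^d` sending a function to the family of its fibres, and a
commutative triangle to the family of the functions that it induces on the fibres. -/
noncomputable def FinS.fibres (d : FinS.{u}) : Over d ⥤ (Idx d → FinS.{u}) where
  obj f j := FinS.fib f.hom j
  map {f f'} g j := FinS.fibMap f.hom f'.hom g.left (Over.w g) j
  map_id f := by
    funext j i
    apply FinS.incl_injective f.hom j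
    exact FinS.incl_fibMap _ _ _ (Over.w (𝟙 f)) _ _
  map_comp {f g h} a b := by
    funext j i
    apply FinS.incl_injective h.hom j
    refine (FinS.incl_fibMap _ _ _ (Over.w (a ≫ b)) _ _).trans ?_
    refine Eq.trans ?_ (FinS.incl_fibMap _ _ _ (Over.w b) j
      (FinS.app (FinS.fibMap _ _ _ (Over.w a) j) i)).symm
    exact congrArg (FinS.app b.left) (FinS.incl_fibMap _ _ _ (Over.w a) _ _).symm

/-! ### Operadic categories -/

/-- The data of an operadic category: a cardinality functor `|·| : C ⥤ 𝒮` and functors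
`R_c : C/c ⥤ C^{|c|}` which are compatible with the fibre functors of `𝒮`. -/
class OperadicData (C : Type u) [SmallCategory C] where
  /-- The cardinality functor. -/
  card : C ⥤ FinS.{u}
  /-- The fibre functors. -/
  R (c : C) : Over c ⥤ (Idx (card.obj c) → C)
  square (c : C) :
    R c ⋙ Functor.pi (fun _ => card) = Over.post card ⋙ FinS.fibres (card.obj c)

section

variable {C : Type u} [SmallCategory C] [OperadicData C]

/-- The set `|c|`. -/
abbrev El (c : C) : Type u := Idx (OperadicData.card.obj c)

/-- The fibre `ψ⁻¹ j`. -/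
def fib {c d : C} (ψ : c ⟶ d) (j : El d) : C := (OperadicData.R d).obj (Over.mk ψ) j

/-- An object `u` is trivial if `|u| = 1` and `R_u` is the domain functor. -/
def IsTrivial (u : C) : Prop :=
  (OperadicData.card.obj u).len = 1 ∧
    ∀ i : El u, OperadicData.R u ⋙ Pi.eval (fun _ => C) i = Over.forget u

theorem card_fib {c d : C} (ψ : c ⟶ d) (j : El d) :
    OperadicData.card.obj (fib ψ j) = FinS.fib (OperadicData.card.map ψ) j :=
  congrFun (Functor.congr_obj (OperadicData.square d) (Over.mk ψ)) j

/-- The inclusion of `|ψ⁻¹ j| = |ψ|⁻¹ j` in `|c|`. For varying `j` these inclusions are the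
components of the canonical bijection between the sum of the sets `|ψ|⁻¹ j` and `|c|`. -/
noncomputable def fibIncl {c d : C} (ψ : c ⟶ d) (j : El d) (i : El (fib ψ j)) : El c :=
  FinS.incl (OperadicData.card.map ψ) j (Idx.cast (card_fib ψ j) i)

end

/-- An operadic category. The double slice condition says, for `ψ : c ⟶ d`, that two functors from
`(C/d)/ψ` to `C^{|c|}`, the latter seen as the product over `j ∈ |d|` of the `C^{|ψ⁻¹ j|}`, are
equal; we state this one component at a time. -/
class OperadicCategory (C : Type u) [SmallCategory C] extends OperadicData C where
  trivial_fib_id (c : C) (i : El c) : IsTrivial (fib (𝟙 c) i)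
  double_slice {c d : C} (ψ : c ⟶ d) (j : El d) (i : El (fib ψ j)) :
    Over.post (X := Over.mk ψ) (R d ⋙ Pi.eval (fun _ => C) j) ⋙
        R (fib ψ j) ⋙ Pi.eval (fun _ => C) i =
      (Over.mk ψ).iteratedSliceForward ⋙ R c ⋙ Pi.eval (fun _ => C) (fibIncl ψ j i)

/-- A strict operadic functor: a functor which strictly commutes with the cardinality functors and
with the functors `R`, the latter being stated one component at a time. -/
@[ext]
structure StrictOperadicFunctor (C D : Type u) [SmallCategory C] [SmallCategory D]
    [OperadicCategory C] [OperadicCategory D] where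
  functor : C ⥤ D
  card_comp : functor ⋙ OperadicData.card = OperadicData.card
  R_comp (c : C) (i : El c) :
    OperadicData.R c ⋙ Pi.eval (fun _ => C) i ⋙ functor =
      Over.post functor ⋙ OperadicData.R (functor.obj c) ⋙
        Pi.eval (fun _ => D) (Idx.cast (Functor.congr_obj card_comp c).symm i)

/-- The identity, as a strict operadic functor. -/
def StrictOperadicFunctor.id (C : Type u) [SmallCategory C] [OperadicCategory C] :
    StrictOperadicFunctor C C where
  functor := 𝟭 C
  card_comp := rfl
  R_comp _ _ := rfl

/-- The composite of strict operadic functors. -/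
def StrictOperadicFunctor.comp {C D E : Type u} [SmallCategory C] [SmallCategory D]
    [SmallCategory E] [OperadicCategory C] [OperadicCategory D] [OperadicCategory E]
    (F : StrictOperadicFunctor C D) (G : StrictOperadicFunctor D E) :
    StrictOperadicFunctor C E where
  functor := F.functor ⋙ G.functor
  card_comp := by rw [Functor.assoc, G.card_comp, F.card_comp]
  R_comp c i := by
    have h1 := congrArg (fun H => H ⋙ G.functor) (F.R_comp c i)
    have h2 := congrArg (fun H => Over.post F.functor ⋙ H) (G.R_comp (F.functor.obj c)
      (Idx.cast (Functor.congr_obj F.card_comp c).symm i))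
    exact h1.trans h2

/-- The category `OpCat` of (small) operadic categories and strict operadic functors. -/
structure OpCat : Type (u + 1) where
  carrier : Type u
  [category : SmallCategory carrier]
  [operadic : OperadicCategory carrier]

attribute [instance] OpCat.category OpCat.operadic

instance : Category OpCat.{u} where
  Hom C D := StrictOperadicFunctor C.carrier D.carrier
  id C := StrictOperadicFunctor.id C.carrier
  comp F G := F.comp G

/-! ### The operadic category of finite sets -/

theorem FinS.heq_of_val {X X' Y Y' : FinS.{u}} (f : X ⟶ Y) (g : X' ⟶ Y') (hX : X = X')
    (hY : Y = Y') (h : ∀ (i : Idx X) (i' : Idx X'), i.down.val = i'.down.val →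
      (FinS.app f i).down.val = (FinS.app g i').down.val) : f ≍ g := by
  subst hX hY
  apply heq_of_eq
  funext i
  exact ULift.ext _ _ (Fin.ext (h i i rfl))

theorem FinS.fib_unique {X Y Z : FinS.{u}} (f : X ⟶ Y) (j : Idx Y) (e : Idx Z → Idx X)
    (mono : ∀ a b, a.down < b.down → (e a).down < (e b).down)
    (he : ∀ k, FinS.app f k = j ↔ ∃ a, e a = k) :
    Z = FinS.fib f j ∧ ∀ (i : Idx Z) (i' : Idx (FinS.fib f j)),
      i.down.val = i'.down.val → e i = FinS.incl f j i' := by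
  have hm : StrictMono (fun k : Fin Z.len => (e ⟨k⟩).down) := fun a b h => mono ⟨a⟩ ⟨b⟩ h
  have hs : FinS.preim f j = Finset.univ.image (fun k : Fin Z.len => (e ⟨k⟩).down) := by
    ext k
    simp only [FinS.preim, Finset.mem_filter, Finset.mem_univ, true_and, Finset.mem_image, he]
    constructor
    · rintro ⟨⟨a⟩, h⟩
      exact ⟨a, by rw [h]⟩
    · rintro ⟨a, h⟩
      exact ⟨⟨a⟩, ULift.ext _ _ h⟩
  have hc : (FinS.preim f j).card = Z.len := by
    rw [hs, Finset.card_image_of_injective _ hm.injective, Finset.card_univ, Fintype.card_fin]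
  refine ⟨FintypeCat.Skeleton.ext _ _ hc.symm, fun i i' hi => ULift.ext _ _ ?_⟩
  have h1 := Finset.orderEmbOfFin_unique hc (f := fun k : Fin Z.len => (e ⟨k⟩).down)
    (fun k => by rw [hs]; exact Finset.mem_image_of_mem _ (Finset.mem_univ _)) hm
  have h2 := congrFun h1 i.down
  refine h2.trans ?_
  exact Finset.orderEmbOfFin_eq_orderEmbOfFin_iff.2 hi

theorem FinS.incl_mono {X Y : FinS.{u}} (f : X ⟶ Y) (j : Idx Y) (a b : Idx (FinS.fib f j))
    (h : a.down < b.down) : (FinS.incl f j a).down < (FinS.incl f j b).down :=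
  ((FinS.preim f j).orderEmbOfFin rfl).strictMono h

theorem FinS.incl_val {X Y : FinS.{u}} (f : X ⟶ Y) (j j' : Idx Y) (hj : j = j')
    (a : Idx (FinS.fib f j)) (b : Idx (FinS.fib f j')) (h : a.down.val = b.down.val) :
    FinS.incl f j a = FinS.incl f j' b := by
  subst hj
  exact congrArg _ (ULift.ext _ _ (Fin.ext h))

theorem FinS.incl_incl {X Y Z : FinS.{u}} (f : X ⟶ Y) (g : Y ⟶ Z) (h : X ⟶ Z) (w : f ≫ g = h)
    (j : Idx Z) (i : Idx (FinS.fib g j)) :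
    FinS.fib (FinS.fibMap h g f w j) i = FinS.fib f (FinS.incl g j i) ∧
      ∀ (k : Idx (FinS.fib (FinS.fibMap h g f w j) i)) (k' : Idx (FinS.fib f (FinS.incl g j i))),
        k.down.val = k'.down.val →
          FinS.incl h j (FinS.incl (FinS.fibMap h g f w j) i k) =
            FinS.incl f (FinS.incl g j i) k' := by
  refine FinS.fib_unique f (FinS.incl g j i) (fun k => FinS.incl h j (FinS.incl _ i k))
    (fun a b h => FinS.incl_mono _ _ _ _ (FinS.incl_mono _ _ _ _ h)) (fun k => ?_)
  constructor
  · intro hk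
    have hw : FinS.app h k = j := by
      refine (congrFun w k).symm.trans (Eq.trans ?_ (FinS.app_incl g j i))
      exact congrArg (FinS.app g) hk
    refine ⟨FinS.lift _ i (FinS.lift h j k hw) ?_, ?_⟩
    · apply FinS.incl_injective g j
      refine (FinS.incl_fibMap _ _ _ w _ _).trans ?_
      rw [FinS.incl_lift]
      exact hk
    · exact (congrArg _ (FinS.incl_lift _ _ _ _)).trans (FinS.incl_lift _ _ _ _)
  · rintro ⟨a, rfl⟩
    have h1 := FinS.app_incl (FinS.fibMap h g f w j) i a
    exact (FinS.incl_fibMap _ _ _ w _ _).symm.trans (congrArg (FinS.incl g j) h1)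

theorem FinS.incl_full {X Y : FinS.{u}} (f : X ⟶ Y) (hY : Y.len = 1) (j : Idx Y) :
    X = FinS.fib f j ∧ ∀ (k : Idx X) (k' : Idx (FinS.fib f j)),
      k.down.val = k'.down.val → k = FinS.incl f j k' :=
  FinS.fib_unique f j (fun a => a) (fun _ _ h => h) fun k => by
    refine ⟨fun _ => ⟨k, rfl⟩, fun _ => ULift.ext _ _ (Fin.ext ?_)⟩
    have h1 := (FinS.app f k).down.isLt
    have h2 := j.down.isLt
    omega

/-- The operadic category `𝒮`. -/
noncomputable instance : OperadicData FinS.{u} where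
  card := 𝟭 _
  R := FinS.fibres
  square _ := rfl

theorem FinS.isTrivial {c : FinS.{u}} (h : c.len = 1) : IsTrivial c := by
  refine ⟨h, fun i => ?_⟩
  have key := fun f : Over c => FinS.incl_full f.hom h i
  refine Functor.hext (fun f => (key f).1.symm) fun f g a => ?_
  refine FinS.heq_of_val _ _ (key f).1.symm (key g).1.symm fun k k' hk => ?_
  have h1 := (key f).2 k' k hk.symm
  have h3 : FinS.incl g.hom i (FinS.app (((FinS.fibres c).map a) i) k) =
      FinS.app a.left (FinS.incl f.hom i k) := FinS.incl_fibMap _ _ _ (Over.w a) _ _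
  rw [← h1] at h3
  have h4 := (key g).2 (Idx.cast (key g).1.symm (FinS.app (((FinS.fibres c).map a) i) k))
    (FinS.app (((FinS.fibres c).map a) i) k) rfl
  exact congrArg (fun t => t.down.val) (h4.trans h3)

noncomputable instance : OperadicCategory FinS.{u} where
  trivial_fib_id c i := by
    apply FinS.isTrivial
    change (FinS.preim (𝟙 c) i).card = 1
    rw [Finset.card_eq_one]
    refine ⟨i.down, ?_⟩
    ext k
    simp only [FinS.preim, Finset.mem_filter, Finset.mem_univ, true_and, Finset.mem_singleton]
    exact ⟨fun h => congrArg ULift.down h, fun h => ULift.ext _ _ h⟩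
  double_slice {c d} ψ j i := by
    have key := fun f : Over (Over.mk ψ) =>
      FinS.incl_incl f.hom.left ψ f.left.hom (Over.w f.hom) j i
    refine Functor.hext (fun f => (key f).1) fun f g a => ?_
    refine FinS.heq_of_val _ _ (key f).1 (key g).1 fun k k' hk => ?_
    have h1 := (key f).2 k k' hk
    have h2 := (key g).2
      (FinS.app (((FinS.fibres (FinS.fib ψ j)).map
        ((Over.post (X := Over.mk ψ) (FinS.fibres d ⋙ Pi.eval (fun _ => FinS.{u}) j)).map a)) i) k)
      (Idx.cast (key g).1 (FinS.app (((FinS.fibres (FinS.fib ψ j)).map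
        ((Over.post (X := Over.mk ψ) (FinS.fibres d ⋙ Pi.eval (fun _ => FinS.{u}) j)).map a)) i) k))
      rfl
    have h3 : FinS.incl g.hom.left (FinS.incl ψ j i) (FinS.app (((FinS.fibres c).map
        ((Over.mk ψ).iteratedSliceForward.map a)) (FinS.incl ψ j i)) k') =
        FinS.app a.left.left (FinS.incl f.hom.left (FinS.incl ψ j i) k') :=
      FinS.incl_fibMap _ _ _ (Over.w ((Over.mk ψ).iteratedSliceForward.map a)) _ _
    have h4 : FinS.incl (((FinS.fibres d).map g.hom) j) i
      (FinS.app (((FinS.fibres (FinS.fib ψ j)).map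
        ((Over.post (X := Over.mk ψ) (FinS.fibres d ⋙ Pi.eval (fun _ => FinS.{u}) j)).map a)) i) k)
        = FinS.app (((FinS.fibres d).map a.left) j) (FinS.incl _ i k) :=
      FinS.incl_fibMap _ _ _ (Over.w
        ((Over.post (X := Over.mk ψ) (FinS.fibres d ⋙ Pi.eval (fun _ => FinS.{u}) j)).map a)) _ _
    have h5 : FinS.incl g.left.hom j (FinS.app (((FinS.fibres d).map a.left) j)
        (FinS.incl (((FinS.fibres d).map f.hom) j) i k)) = FinS.app a.left.left
          (FinS.incl f.left.hom j (FinS.incl _ i k)) :=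
      FinS.incl_fibMap _ _ _ (Over.w a.left) _ _
    have h6 := FinS.incl_injective _ _ <| h2.symm.trans <| (congrArg _ h4).trans <| h5.trans <|
      (congrArg _ h1).trans h3.symm
    exact congrArg (fun t => t.down.val) h6

/-- The operadic category `𝒮` as an object of `OpCat`. -/
noncomputable def OpCat.S : OpCat.{u} := ⟨FinS.{u}⟩

/-- The cardinality functor of an operadic category, as a strict operadic functor to `𝒮`. -/
noncomputable def OpCat.toS (C : OpCat.{u}) : C ⟶ OpCat.S.{u} where
  functor := OperadicData.card
  card_comp := rfl
  R_comp c i := congrArg (fun H => H ⋙ Pi.eval (fun _ => FinS.{u}) i) (OperadicData.square c)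

/-- `𝒮` is the terminal operadic category. -/
theorem OpCat.toS_unique (C : OpCat.{u}) (F : C ⟶ OpCat.S.{u}) : F = C.toS :=
  StrictOperadicFunctor.ext F.card_comp

/-! ### Skew monoidal categories and opmonoidal functors -/

open scoped Prod

/-- A skew monoidal structure on a category; the constraints are not required to be invertible. -/
class SkewMonoidal (E : Type w) [Category.{v} E] where
  tensor : E × E ⥤ E
  unit : E
  α (X Y Z : E) : tensor.obj (tensor.obj (X, Y), Z) ⟶ tensor.obj (X, tensor.obj (Y, Z))
  lam (X : E) : tensor.obj (unit, X) ⟶ X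
  ρ (X : E) : X ⟶ tensor.obj (X, unit)
  α_naturality {X X' Y Y' Z Z' : E} (f : X ⟶ X') (g : Y ⟶ Y') (h : Z ⟶ Z') :
    tensor.map (tensor.map (f ×ₘ g) ×ₘ h) ≫ α X' Y' Z' =
      α X Y Z ≫ tensor.map (f ×ₘ tensor.map (g ×ₘ h))
  lam_naturality {X X' : E} (f : X ⟶ X') :
    tensor.map (𝟙 unit ×ₘ f) ≫ lam X' = lam X ≫ f
  ρ_naturality {X X' : E} (f : X ⟶ X') :
    f ≫ ρ X' = ρ X ≫ tensor.map (f ×ₘ 𝟙 unit)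
  lam_ρ : ρ unit ≫ lam unit = 𝟙 unit
  α_lam (X Y : E) : α unit X Y ≫ lam (tensor.obj (X, Y)) = tensor.map (lam X ×ₘ 𝟙 Y)
  α_ρ (X Y : E) : ρ (tensor.obj (X, Y)) ≫ α X Y unit = tensor.map (𝟙 X ×ₘ ρ Y)
  lam_α_ρ (X Y : E) :
    tensor.map (ρ X ×ₘ 𝟙 Y) ≫ α X unit Y ≫ tensor.map (𝟙 X ×ₘ lam Y) = 𝟙 (tensor.obj (X, Y))
  pentagon (W X Y Z : E) :
    tensor.map (α W X Y ×ₘ 𝟙 Z) ≫ α W (tensor.obj (X, Y)) Z ≫ tensor.map (𝟙 W ×ₘ α X Y Z) =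
      α (tensor.obj (W, X)) Y Z ≫ α W X (tensor.obj (Y, Z))

open SkewMonoidal

theorem tensor_map_comp {E : Type w} [Category.{v} E] [SkewMonoidal E] {X X' X'' Y Y' Y'' : E}
    (f : X ⟶ X') (f' : X' ⟶ X'') (g : Y ⟶ Y') (g' : Y' ⟶ Y'') :
    tensor.map ((f ≫ f') ×ₘ (g ≫ g')) = tensor.map (f ×ₘ g) ≫ tensor.map (f' ×ₘ g') :=
  tensor.map_comp (f ×ₘ g) (f' ×ₘ g')

/-- An opmonoidal functor between skew monoidal categories: a functor `F` with a natural
transformation `F² : F(X * Y) ⟶ FX * FY` and a morphism `F⁰ : FU ⟶ V`, which are compatible with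
the constraints. -/
structure Opmonoidal (E : Type w) [Category.{v} E] [SkewMonoidal E]
    (F : Type w) [Category.{v} F] [SkewMonoidal F] where
  functor : E ⥤ F
  two : tensor (E := E) ⋙ functor ⟶ functor.prod functor ⋙ tensor (E := F)
  zero : functor.obj (unit (E := E)) ⟶ unit (E := F)
  two_α (X Y Z : E) :
    two.app (tensor.obj (X, Y), Z) ≫ tensor.map (two.app (X, Y) ×ₘ 𝟙 (functor.obj Z)) ≫
        α (functor.obj X) (functor.obj Y) (functor.obj Z) =
      functor.map (α X Y Z) ≫ two.app (X, tensor.obj (Y, Z)) ≫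
        tensor.map (𝟙 (functor.obj X) ×ₘ two.app (Y, Z))
  two_lam (X : E) :
    two.app (unit, X) ≫ tensor.map (zero ×ₘ 𝟙 (functor.obj X)) ≫ lam (functor.obj X) =
      functor.map (lam X)
  two_ρ (X : E) :
    functor.map (ρ X) ≫ two.app (X, unit) ≫ tensor.map (𝟙 (functor.obj X) ×ₘ zero) =
      ρ (functor.obj X)

namespace Opmonoidal

variable {E F G H : Type w} [Category.{v} E] [SkewMonoidal E] [Category.{v} F] [SkewMonoidal F]
  [Category.{v} G] [SkewMonoidal G] [Category.{v} H] [SkewMonoidal H]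

/-- Opmonoidal functors are equal if their underlying functors and structure maps are. -/
theorem eq_of_heq {P Q : Opmonoidal E F} (h : P.functor = Q.functor)
    (h2 : ∀ X Y, P.two.app (X, Y) ≍ Q.two.app (X, Y)) (h0 : P.zero ≍ Q.zero) : P = Q := by
  obtain ⟨p, p2, p0, _, _, _⟩ := P
  obtain ⟨q, q2, q0, _, _, _⟩ := Q
  obtain rfl : p = q := h
  obtain rfl : p2 = q2 := by
    ext ⟨X, Y⟩
    exact _root_.eq_of_heq (h2 X Y)
  obtain rfl : p0 = q0 := _root_.eq_of_heq h0
  rfl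

/-- The identity opmonoidal functor. -/
def id (E : Type w) [Category.{v} E] [SkewMonoidal E] : Opmonoidal E E where
  functor := 𝟭 E
  two := { app := fun XY => 𝟙 (tensor.obj XY), naturality := fun _ _ f =>
    (Category.comp_id _).trans (Category.id_comp _).symm }
  zero := 𝟙 unit
  two_α X Y Z := by
    refine (Category.id_comp _).trans ?_
    refine Eq.trans ?_ (congrArg (α X Y Z ≫ ·) (Category.id_comp _).symm)
    refine (congrArg (· ≫ α X Y Z) (tensor.map_id _)).trans ?_
    refine Eq.trans ?_ (congrArg (α X Y Z ≫ ·) (tensor.map_id _).symm)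
    exact (Category.id_comp _).trans (Category.comp_id _).symm
  two_lam X := by
    refine (Category.id_comp _).trans ?_
    exact (congrArg (· ≫ lam X) (tensor.map_id _)).trans (Category.id_comp _)
  two_ρ X := by
    refine (congrArg (ρ X ≫ ·) (Category.id_comp _)).trans ?_
    exact (congrArg (ρ X ≫ ·) (tensor.map_id _)).trans (Category.comp_id _)

/-- The composite of opmonoidal functors. -/
def comp (P : Opmonoidal E F) (Q : Opmonoidal F G) : Opmonoidal E G where
  functor := P.functor ⋙ Q.functor
  two :=
    { app := fun XY => Q.functor.map (P.two.app XY) ≫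
        Q.two.app (P.functor.obj XY.1, P.functor.obj XY.2)
      naturality := fun XY XY' f => by
        have h1 := P.two.naturality f
        have h2 := Q.two.naturality (P.functor.map f.1 ×ₘ P.functor.map f.2)
        dsimp at h1 h2 ⊢
        rw [← Category.assoc, ← Functor.map_comp, h1, Functor.map_comp, Category.assoc, h2,
          Category.assoc] }
  zero := Q.functor.map P.zero ≫ Q.zero
  two_α X Y Z := by
    have e1 := congrArg Q.functor.map (P.two_α X Y Z)
    have e2 := Q.two_α (P.functor.obj X) (P.functor.obj Y) (P.functor.obj Z)
    have n1 := Q.two.naturality (P.two.app (X, Y) ×ₘ 𝟙 (P.functor.obj Z))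
    have n2 := Q.two.naturality (𝟙 (P.functor.obj X) ×ₘ P.two.app (Y, Z))
    have t1 := tensor_map_comp (Q.functor.map (P.two.app (X, Y)))
      (Q.two.app (P.functor.obj X, P.functor.obj Y)) (𝟙 (Q.functor.obj (P.functor.obj Z))) (𝟙 _)
    have t2 := tensor_map_comp (𝟙 (Q.functor.obj (P.functor.obj X))) (𝟙 _)
      (Q.functor.map (P.two.app (Y, Z))) (Q.two.app (P.functor.obj Y, P.functor.obj Z))
    dsimp at e1 e2 n1 n2 t1 t2 ⊢
    rw [Category.comp_id] at t1 t2
    rw [CategoryTheory.Functor.map_id] at n1 n2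
    simp only [Functor.map_comp] at e1
    rw [t1, t2]
    simp only [Category.assoc]
    rw [reassoc_of% n1.symm, reassoc_of% n2.symm, e2, reassoc_of% e1]
  two_lam X := by
    have e1 := congrArg Q.functor.map (P.two_lam X)
    have e2 := Q.two_lam (P.functor.obj X)
    have n1 := Q.two.naturality (P.zero ×ₘ 𝟙 (P.functor.obj X))
    have t1 := tensor_map_comp (Q.functor.map P.zero)
      Q.zero (𝟙 (Q.functor.obj (P.functor.obj X))) (𝟙 _)
    dsimp at e1 e2 n1 t1 ⊢
    rw [Category.comp_id] at t1
    rw [CategoryTheory.Functor.map_id] at n1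
    simp only [Functor.map_comp] at e1
    rw [t1]
    simp only [Category.assoc]
    rw [reassoc_of% n1.symm, e2, e1]
  two_ρ X := by
    have e1 := congrArg Q.functor.map (P.two_ρ X)
    have e2 := Q.two_ρ (P.functor.obj X)
    have n1 := Q.two.naturality (𝟙 (P.functor.obj X) ×ₘ P.zero)
    have t1 := tensor_map_comp (𝟙 (Q.functor.obj (P.functor.obj X))) (𝟙 _)
      (Q.functor.map P.zero) Q.zero
    dsimp at e1 e2 n1 t1 ⊢
    rw [Category.comp_id] at t1
    rw [CategoryTheory.Functor.map_id] at n1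
    simp only [Functor.map_comp] at e1
    rw [t1]
    simp only [Category.assoc]
    rw [reassoc_of% n1.symm, reassoc_of% e1, e2]

end Opmonoidal

/-- The category `SkewMonCat` of skew monoidal categories and opmonoidal functors. -/
structure SkewMonCat : Type (max (w + 1) (v + 1)) where
  carrier : Type w
  [category : Category.{v} carrier]
  [skewMonoidal : SkewMonoidal carrier]

attribute [instance] SkewMonCat.category SkewMonCat.skewMonoidal

instance : Category SkewMonCat.{v, w} where
  Hom E F := Opmonoidal E.carrier F.carrier
  id E := Opmonoidal.id E.carrier
  comp P Q := P.comp Q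
  id_comp {E F} P := by
    refine Opmonoidal.eq_of_heq rfl (fun X Y => heq_of_eq ?_) (heq_of_eq ?_)
    · exact (congrArg (· ≫ P.two.app (X, Y)) (P.functor.map_id _)).trans (Category.id_comp _)
    · exact (congrArg (· ≫ P.zero) (P.functor.map_id _)).trans (Category.id_comp _)
  comp_id {E F} P := by
    refine Opmonoidal.eq_of_heq rfl (fun X Y => heq_of_eq ?_) (heq_of_eq ?_)
    · exact Category.comp_id _
    · exact Category.comp_id _
  assoc {E F G H} P Q R := by
    refine Opmonoidal.eq_of_heq rfl (fun X Y => heq_of_eq ?_) (heq_of_eq ?_)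
    · exact (congrArg (· ≫ R.two.app _) (R.functor.map_comp _ _)).trans (Category.assoc _ _ _)
    · exact (congrArg (· ≫ R.zero) (R.functor.map_comp _ _)).trans (Category.assoc _ _ _)

/-! ### The skew monoidal category of collections -/

section Collections

variable {C : Type u} [SmallCategory C]

/-- The structure map `∂ : X → C` of an object of the slice category `Set/C`. -/
def bd {C : Type u} (X : Over C) : X.left → C := X.hom

/-- The function underlying a morphism of `Set/C`. -/
def fn {C : Type u} {X Y : Over C} (f : X ⟶ Y) : X.left → Y.left := f.left

theorem bd_fn {C : Type u} {X Y : Over C} (f : X ⟶ Y) (x : X.left) : bd Y (fn f x) = bd X x :=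
  types_congr_hom (Over.w f) x

/-- The object of `Set/C` given by a function `X → C`. -/
def sliceMk {C X : Type u} (d : X → C) : Over C := Over.mk (↾d)

/-- The morphism of `Set/C` given by a function over `C`. -/
def sliceHom {C : Type u} {X Y : Over C} (f : X.left → Y.left) (h : ∀ x, bd Y (f x) = bd X x) :
    X ⟶ Y :=
  Over.homMk (↾f) (by ext x; exact h x)

theorem sliceHom_ext {C : Type u} {X Y : Over C} {f g : X ⟶ Y} (h : ∀ x, fn f x = fn g x) :
    f = g := by
  ext x
  exact h x

/-- The elements of `X * Y`: a morphism `φ : c ⟶ d`, an element `x ∈ X_d`, and a family of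
elements `y_i ∈ Y_{φ⁻¹ i}` for `i ∈ |d|`. -/
structure TensorEl [OperadicData C] (X Y : Over C) : Type u where
  dom : C
  cod : C
  φ : dom ⟶ cod
  x : X.left
  hx : bd X x = cod
  y : El cod → Y.left
  hy : ∀ i, bd Y (y i) = fib φ i

section data

variable [OperadicData C]

theorem TensorEl.ext' {X Y : Over C} {s t : TensorEl X Y} (hd : s.dom = t.dom)
    (hc : s.cod = t.cod) (hφ : s.φ ≍ t.φ) (hx : s.x = t.x)
    (hy : ∀ (i : El s.cod) (j : El t.cod), i.down.val = j.down.val → s.y i = t.y j) : s = t := by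
  obtain ⟨a, b, φ, x, h, y, h'⟩ := s
  obtain ⟨a', b', φ', x', h1, y', h1'⟩ := t
  obtain rfl : a = a' := hd
  obtain rfl : b = b' := hc
  obtain rfl : φ = φ' := eq_of_heq hφ
  obtain rfl : x = x' := hx
  obtain rfl : y = y' := funext fun i => hy i i rfl
  rfl

/-- The tensor product `X * Y`, where `∂` sends an element to the domain of its morphism. -/
def collTensorObj (X Y : Over C) : Over C := sliceMk (fun s : TensorEl X Y => s.dom)

/-- The tensor product of morphisms. -/
def collTensorMap {X X' Y Y' : Over C} (f : X ⟶ X') (g : Y ⟶ Y') :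
    collTensorObj X Y ⟶ collTensorObj X' Y' :=
  sliceHom (fun s : TensorEl X Y => (⟨s.dom, s.cod, s.φ, fn f s.x, (bd_fn f _).trans s.hx,
    fun i => fn g (s.y i), fun i => (bd_fn g _).trans (s.hy i)⟩ : TensorEl X' Y')) (fun _ => rfl)

/-- The functor `*`. -/
def collTensor : Over C × Over C ⥤ Over C where
  obj XY := collTensorObj XY.1 XY.2
  map f := collTensorMap f.1 f.2
  map_id _ := rfl
  map_comp _ _ := rfl

/-- The unit `U`: the set of trivial objects. -/
def collUnit (C : Type u) [SmallCategory C] [OperadicData C] : Over C :=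
  sliceMk (Subtype.val : {u : C // IsTrivial u} → C)

end data

variable [OperadicCategory C]

/-- The morphism `φ^ψ_j : θ⁻¹ j ⟶ ψ⁻¹ j` where `θ` is the composite of `φ` and `ψ`. -/
def tri {b c d : C} (φ : b ⟶ c) (ψ : c ⟶ d) (θ : b ⟶ d) (h : φ ≫ ψ = θ) (j : El d) :
    fib θ j ⟶ fib ψ j :=
  (OperadicData.R d).map (Over.homMk φ h : Over.mk θ ⟶ Over.mk ψ) j

theorem fib_tri {b c d : C} (φ : b ⟶ c) (ψ : c ⟶ d) (θ : b ⟶ d) (h : φ ≫ ψ = θ) (j : El d)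
    (i : El (fib ψ j)) : fib (tri φ ψ θ h j) i = fib φ (fibIncl ψ j i) :=
  Functor.congr_obj (OperadicCategory.double_slice ψ j i)
    (Over.mk (Over.homMk φ h : Over.mk θ ⟶ Over.mk ψ))

theorem tri_tri {a b c d : C} (χ : a ⟶ b) (φ : b ⟶ c) (ψ : c ⟶ d) (χφ : a ⟶ c) (φψ : b ⟶ d)
    (χφψ : a ⟶ d) (h1 : χ ≫ φ = χφ) (h2 : φ ≫ ψ = φψ) (h3 : χ ≫ φψ = χφψ) (h4 : χφ ≫ ψ = χφψ)
    (j : El d) (i : El (fib ψ j))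
    (h : tri χ φψ χφψ h3 j ≫ tri φ ψ φψ h2 j = tri χφ ψ χφψ h4 j) :
    tri (tri χ φψ χφψ h3 j) (tri φ ψ φψ h2 j) (tri χφ ψ χφψ h4 j) h i ≍
      tri χ φ χφ h1 (fibIncl ψ j i) :=
  Functor.hcongr_hom (OperadicCategory.double_slice ψ j i)
    (Over.homMk (Over.homMk χ h3) (by ext; exact h1) :
      Over.mk (Over.homMk χφ h4 : Over.mk χφψ ⟶ Over.mk ψ) ⟶
        Over.mk (Over.homMk φ h2 : Over.mk φψ ⟶ Over.mk ψ))

theorem tri_comp {a b c d : C} (χ : a ⟶ b) (φ : b ⟶ c) (ψ : c ⟶ d) (χφ : a ⟶ c) (φψ : b ⟶ d)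
    (χφψ : a ⟶ d) (h1 : χ ≫ φ = χφ) (h2 : φ ≫ ψ = φψ) (h3 : χ ≫ φψ = χφψ) (h4 : χφ ≫ ψ = χφψ)
    (j : El d) :
    tri χ φψ χφψ h3 j ≫ tri φ ψ φψ h2 j = tri χφ ψ χφψ h4 j := by
  subst h1
  exact (congrFun ((OperadicData.R d).map_comp (Over.homMk χ h3 : Over.mk χφψ ⟶ Over.mk φψ)
    (Over.homMk φ h2 : Over.mk φψ ⟶ Over.mk ψ)) j).symm

theorem tri_id {c d : C} (ψ : c ⟶ d) (h : 𝟙 c ≫ ψ = ψ) (j : El d) :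
    tri (𝟙 c) ψ ψ h j = 𝟙 (fib ψ j) :=
  congrFun ((OperadicData.R d).map_id (Over.mk ψ)) j

theorem fib_trivial {c u : C} (hu : IsTrivial u) (φ : c ⟶ u) (i : El u) : fib φ i = c :=
  Functor.congr_obj (hu.2 i) (Over.mk φ)

theorem tri_trivial {b c u : C} (hu : IsTrivial u) (φ : b ⟶ c) (ψ : c ⟶ u) (θ : b ⟶ u)
    (h : φ ≫ ψ = θ) (i : El u) : tri φ ψ θ h i ≍ φ :=
  Functor.hcongr_hom (hu.2 i) (Over.homMk φ h : Over.mk θ ⟶ Over.mk ψ)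

theorem fib_congr {c c' d d' : C} {φ : c ⟶ d} {φ' : c' ⟶ d'} (hc : c = c') (hd : d = d')
    (h : φ ≍ φ') (i : El d) (i' : El d') (hi : i.down.val = i'.down.val) : fib φ i = fib φ' i' := by
  subst hc hd
  obtain rfl := eq_of_heq h
  obtain rfl : i = i' := ULift.ext _ _ (Fin.ext hi)
  rfl

theorem tri_congr {b c d b' c' d' : C} {φ : b ⟶ c} {ψ : c ⟶ d} {θ : b ⟶ d} {h : φ ≫ ψ = θ}
    {φ' : b' ⟶ c'} {ψ' : c' ⟶ d'} {θ' : b' ⟶ d'} {h' : φ' ≫ ψ' = θ'} (hb : b = b') (hc : c = c')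
    (hd : d = d') (hφ : φ ≍ φ') (hψ : ψ ≍ ψ') (i : El d) (i' : El d')
    (hi : i.down.val = i'.down.val) : tri φ ψ θ h i ≍ tri φ' ψ' θ' h' i' := by
  subst hb hc hd
  obtain rfl := eq_of_heq hφ
  obtain rfl := eq_of_heq hψ
  subst h h'
  obtain rfl : i = i' := ULift.ext _ _ (Fin.ext hi)
  rfl

theorem tri_id' {c d : C} (ψ θ : c ⟶ d) (h : 𝟙 c ≫ ψ = θ) (j : El d) :
    tri (𝟙 c) ψ θ h j ≍ 𝟙 (fib ψ j) := by
  obtain rfl : ψ = θ := (Category.id_comp ψ).symm.trans h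
  exact heq_of_eq (tri_id ψ h j)

theorem FinS.incl_congr {X X' Y Y' : FinS.{u}} {f : X ⟶ Y} {f' : X' ⟶ Y'} (hX : X = X')
    (hY : Y = Y') (h : f ≍ f') (j : Idx Y) (j' : Idx Y') (hj : j.down.val = j'.down.val)
    (i : Idx (FinS.fib f j)) (i' : Idx (FinS.fib f' j')) (hi : i.down.val = i'.down.val) :
    (FinS.incl f j i).down.val = (FinS.incl f' j' i').down.val := by
  subst hX hY
  obtain rfl := eq_of_heq h
  obtain rfl : j = j' := ULift.ext _ _ (Fin.ext hj)
  obtain rfl : i = i' := ULift.ext _ _ (Fin.ext hi)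
  rfl

theorem card_tri {b c d : C} (φ : b ⟶ c) (ψ : c ⟶ d) (θ : b ⟶ d) (h : φ ≫ ψ = θ) (j : El d)
    (h' : OperadicData.card.map φ ≫ OperadicData.card.map ψ = OperadicData.card.map θ) :
    OperadicData.card.map (tri φ ψ θ h j) ≍
      FinS.fibMap (OperadicData.card.map θ) (OperadicData.card.map ψ)
        (OperadicData.card.map φ) h' j :=
  Functor.hcongr_hom (congrArg (fun H => H ⋙ Pi.eval (fun _ => FinS.{u}) j)
    (OperadicData.square d)) (Over.homMk φ h : Over.mk θ ⟶ Over.mk ψ)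

theorem fibIncl_fibIncl {b c d : C} (φ : b ⟶ c) (ψ : c ⟶ d) (θ : b ⟶ d) (h : φ ≫ ψ = θ)
    (j : El d) (i : El (fib ψ j)) (k : El (fib (tri φ ψ θ h j) i))
    (k' : El (fib φ (fibIncl ψ j i))) (hk : k.down.val = k'.down.val) :
    fibIncl θ j (fibIncl (tri φ ψ θ h j) i k) = fibIncl φ (fibIncl ψ j i) k' := by
  have h' : OperadicData.card.map φ ≫ OperadicData.card.map ψ = OperadicData.card.map θ := by
    rw [← h, Functor.map_comp]
  obtain ⟨h1, h2⟩ := FinS.incl_incl _ _ _ h' j (Idx.cast (card_fib ψ j) i)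
  have h3 := h2 (Idx.cast h1.symm (Idx.cast (card_fib φ (fibIncl ψ j i)) k'))
    (Idx.cast (card_fib φ (fibIncl ψ j i)) k') rfl
  refine Eq.trans ?_ h3
  refine FinS.incl_val _ _ _ rfl _ _ ?_
  exact FinS.incl_congr (card_fib θ j) (card_fib ψ j) (card_tri φ ψ θ h j h') _ _ rfl _ _ hk

theorem fibIncl_trivial {c u : C} (hu : IsTrivial u) (ψ : c ⟶ u) (j : El u) (i : El (fib ψ j)) :
    (fibIncl ψ j i).down.val = i.down.val := by
  obtain ⟨h1, h2⟩ := FinS.incl_full (OperadicData.card.map ψ) hu.1 j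
  have h3 := h2 (Idx.cast h1.symm (Idx.cast (card_fib ψ j) i)) (Idx.cast (card_fib ψ j) i) rfl
  exact (congrArg (fun t => t.down.val) h3).symm

theorem fibIncl_id (c : C) (j : El c) (i : El (fib (𝟙 c) j)) : fibIncl (𝟙 c) j i = j := by
  have h := FinS.app_incl (OperadicData.card.map (𝟙 c)) j (Idx.cast (card_fib (𝟙 c) j) i)
  exact (congrFun (OperadicData.card.map_id c) _).symm.trans h

/-- The associativity constraint `(x, ψ, y, φ, z) ↦ (x, ψφ, y, φ^ψ, z)`, where the element
`t = (x, ψ, y)` of `X * Y` lies over `d`. -/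
noncomputable def collAssocAux {X Y Z : Over C} {c d : C} (φ : c ⟶ d) (t : TensorEl X Y)
    (h : t.dom = d) (z : El d → Z.left) (hz : ∀ i, bd Z (z i) = fib φ i) :
    TensorEl X (collTensorObj Y Z) :=
  match d, h, φ, z, hz with
  | _, rfl, φ, z, hz =>
    ⟨c, t.cod, φ ≫ t.φ, t.x, t.hx,
      fun j => (⟨fib (φ ≫ t.φ) j, fib t.φ j, tri φ t.φ (φ ≫ t.φ) rfl j, t.y j, t.hy j,
        fun i => z (fibIncl t.φ j i),
        fun i => (hz (fibIncl t.φ j i)).trans (fib_tri φ t.φ _ rfl j i).symm⟩ : TensorEl Y Z),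
      fun _ => rfl⟩

/-- The associativity constraint as a function on all of `(X * Y) * Z`. -/
noncomputable def collAssocFun {X Y Z : Over C} (s : TensorEl (collTensorObj X Y) Z) :
    TensorEl X (collTensorObj Y Z) :=
  collAssocAux s.φ s.x s.hx s.y s.hy

theorem collAssocFun_dom {X Y Z : Over C} (s : TensorEl (collTensorObj X Y) Z) :
    (collAssocFun s).dom = s.dom := by
  obtain ⟨c, _, φ, t, rfl, z, hz⟩ := s
  rfl

/-- The left unit constraint `(u, φ, x) ↦ x`. -/
def collLamFun {X : Over C} (s : TensorEl (collUnit C) X) : X.left :=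
  s.y ⟨⟨0, by
    have h : IsTrivial s.cod := s.hx ▸ s.x.2
    exact h.1.symm ▸ Nat.zero_lt_one⟩⟩

theorem collLamFun_bd {X : Over C} (s : TensorEl (collUnit C) X) :
    bd X (collLamFun s) = s.dom :=
  (s.hy _).trans (fib_trivial (s.hx ▸ s.x.2) _ _)

/-- The right unit constraint `x ↦ (x, 1, R1)`. -/
def collRhoFun {X : Over C} (x : X.left) : TensorEl X (collUnit C) :=
  ⟨bd X x, bd X x, 𝟙 _, x, rfl,
    fun i => (⟨fib (𝟙 (bd X x)) i, OperadicCategory.trivial_fib_id _ i⟩ : {u : C // IsTrivial u}),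
    fun _ => rfl⟩

theorem collPentagon {W X Y Z : Over C} (t : TensorEl W X) {c c' : C} (φ' : c' ⟶ t.dom)
    (z' : El t.dom → Y.left) (hz' : ∀ i, bd Y (z' i) = fib φ' i) (φ : c ⟶ c') (z : El c' → Z.left)
    (hz : ∀ i, bd Z (z i) = fib φ i) :
    let s : TensorEl (collTensorObj (collTensorObj W X) Y) Z :=
      ⟨c, c', φ, (⟨c', t.dom, φ', t, rfl, z', hz'⟩ : TensorEl (collTensorObj W X) Y), rfl, z, hz⟩
    let s1 : TensorEl (collTensorObj W (collTensorObj X Y)) Z :=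
      ⟨c, c', φ, collAssocFun s.x, rfl, z, hz⟩
    let s2 : TensorEl W (collTensorObj (collTensorObj X Y) Z) := collAssocFun s1
    let s3 : TensorEl W (collTensorObj X (collTensorObj Y Z)) :=
      ⟨s2.dom, s2.cod, s2.φ, s2.x, s2.hx, fun i => collAssocFun (s2.y i),
        fun i => (collAssocFun_dom _).trans (s2.hy i)⟩
    let s4 : TensorEl (collTensorObj W X) (collTensorObj Y Z) := collAssocFun s
    s3 = collAssocFun s4 := by
  intro s s1 s2 s3 s4
  refine TensorEl.ext' rfl rfl (heq_of_eq (Category.assoc _ _ _).symm) rfl fun j j' hj => ?_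
  obtain rfl : j = j' := ULift.ext _ _ (Fin.ext hj)
  have e1 : fib (φ ≫ φ' ≫ t.φ) j = fib ((φ ≫ φ') ≫ t.φ) j := by rw [Category.assoc]
  have h3 : φ ≫ φ' ≫ t.φ = (φ ≫ φ') ≫ t.φ := (Category.assoc _ _ _).symm
  have e2 : tri φ (φ' ≫ t.φ) (φ ≫ φ' ≫ t.φ) rfl j ≫ tri φ' t.φ (φ' ≫ t.φ) rfl j ≍
      tri (φ ≫ φ') t.φ ((φ ≫ φ') ≫ t.φ) rfl j :=
    (heq_of_eq (tri_comp φ φ' t.φ (φ ≫ φ') (φ' ≫ t.φ) (φ ≫ φ' ≫ t.φ) rfl rfl rfl h3.symm j)).trans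
      (tri_congr rfl rfl rfl HEq.rfl HEq.rfl _ _ rfl)
  refine TensorEl.ext' e1 rfl e2 rfl fun i i' hi => ?_
  obtain rfl : i = i' := ULift.ext _ _ (Fin.ext hi)
  have hh := tri_comp φ φ' t.φ (φ ≫ φ') (φ' ≫ t.φ) (φ ≫ φ' ≫ t.φ) rfl rfl rfl h3.symm j
  have f1 : fib (tri φ (φ' ≫ t.φ) (φ ≫ φ' ≫ t.φ) rfl j ≫ tri φ' t.φ (φ' ≫ t.φ) rfl j) i =
      fib (φ ≫ φ') (fibIncl t.φ j i) :=
    (fib_congr e1 rfl e2 i i rfl).trans (fib_tri _ _ _ _ _ _)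
  refine TensorEl.ext' f1 (fib_tri _ _ _ _ _ _) ?_ rfl fun k k' hk => ?_
  · exact (tri_congr rfl rfl rfl HEq.rfl HEq.rfl _ _ rfl).trans
      (tri_tri φ φ' t.φ (φ ≫ φ') (φ' ≫ t.φ) (φ ≫ φ' ≫ t.φ) rfl rfl rfl h3.symm j i hh)
  · exact congrArg z (fibIncl_fibIncl φ' t.φ _ rfl j i k k' hk)

/-- The skew monoidal structure of `Coll_C`. -/
noncomputable instance collSkewMonoidal : SkewMonoidal (Over C) where
  tensor := collTensor
  unit := collUnit C
  α X Y Z := sliceHom (X := collTensorObj (collTensorObj X Y) Z)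
    (Y := collTensorObj X (collTensorObj Y Z)) collAssocFun collAssocFun_dom
  lam X := sliceHom (X := collTensorObj (collUnit C) X) collLamFun collLamFun_bd
  ρ X := sliceHom (Y := collTensorObj X (collUnit C)) collRhoFun (fun _ => rfl)
  α_naturality f g h := sliceHom_ext fun s => by
    obtain ⟨c, _, φ, t, rfl, z, hz⟩ := s
    rfl
  lam_naturality f := rfl
  ρ_naturality f := sliceHom_ext fun x => by
    have h := bd_fn f x
    refine TensorEl.ext' h h ?_ rfl ?_
    · change 𝟙 (bd _ (fn f x)) ≍ 𝟙 (bd _ x)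
      rw [h]
    · intro i j hij
      refine Subtype.ext ?_
      change fib (𝟙 (bd _ (fn f x))) i = fib (𝟙 (bd _ x)) j
      exact fib_congr h h (by rw [h]) i j hij
  lam_ρ := sliceHom_ext fun x => Subtype.ext (fib_trivial x.2 (𝟙 _) _)
  α_lam X Y := sliceHom_ext fun s => by
    obtain ⟨c, _, φ, t, rfl, z, hz⟩ := s
    have ht : IsTrivial (TensorEl.cod t) := TensorEl.hx t ▸ (TensorEl.x t).2
    refine TensorEl.ext' (fib_trivial ht _ _) (fib_trivial ht _ _) (tri_trivial ht _ _ _ rfl _) rfl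
      fun i j hij => ?_
    exact congrArg z (ULift.ext _ _ (Fin.ext ((fibIncl_trivial ht _ _ _).trans hij)))
  α_ρ X Y := sliceHom_ext fun s => by
    refine TensorEl.ext' rfl rfl (heq_of_eq (Category.id_comp _)) rfl fun j j' hj => ?_
    obtain rfl : j = j' := ULift.ext _ _ (Fin.ext hj)
    have e1 := congrArg (fun f => fib f j) (Category.id_comp (TensorEl.φ s))
    have e2 := TensorEl.hy s j
    have e3 : tri (𝟙 s.dom) s.φ (𝟙 s.dom ≫ s.φ) rfl j ≍ 𝟙 (bd Y (s.y j)) :=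
      (tri_id' _ _ _ _).trans (by rw [e2])
    refine TensorEl.ext' (e1.trans e2.symm) e2.symm e3 rfl fun i i' hi => Subtype.ext ?_
    refine (fib_tri (𝟙 s.dom) s.φ _ rfl j i).symm.trans ?_
    exact fib_congr (e1.trans e2.symm) e2.symm e3 i i' hi
  lam_α_ρ X Y := sliceHom_ext fun s => by
    obtain ⟨c, _, φ, x, rfl, y, hy⟩ := s
    refine TensorEl.ext' rfl rfl (heq_of_eq (Category.comp_id _)) rfl fun j j' hj => ?_
    obtain rfl : j = j' := ULift.ext _ _ (Fin.ext hj)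
    exact congrArg y (fibIncl_id _ _ _)
  pentagon W X Y Z := sliceHom_ext fun s => by
    obtain ⟨c, _, φ, ⟨c', _, φ', t, rfl, z', hz'⟩, rfl, z, hz⟩ := s
    exact collPentagon t φ' z' hz' φ z hz

end Collections

/-! ### Functoriality of collections -/

/-- The functor `f_! : Set/C ⥤ Set/D` given by composition with `f : C → D`. -/
def shriek {C D : Type u} (f : C → D) : Over C ⥤ Over D := Over.map (↾f)

namespace StrictOperadicFunctor

variable {C D : Type u} [SmallCategory C] [SmallCategory D]
  [OperadicCategory C] [OperadicCategory D] (F : StrictOperadicFunctor C D)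

/-- The identification of `|c|` with `|Fc|`. -/
def elMap (c : C) (i : El c) : El (F.functor.obj c) :=
  Idx.cast (Functor.congr_obj F.card_comp c).symm i

/-- The identification of `|Fc|` with `|c|`. -/
def elInv (c : C) (i : El (F.functor.obj c)) : El c :=
  Idx.cast (Functor.congr_obj F.card_comp c) i

theorem map_fib {c d : C} (φ : c ⟶ d) (i : El d) :
    F.functor.obj (fib φ i) = fib (F.functor.map φ) (F.elMap d i) :=
  Functor.congr_obj (F.R_comp d i) (Over.mk φ)

theorem map_fib' {c d : C} (φ : c ⟶ d) (i : El (F.functor.obj d)) :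
    F.functor.obj (fib φ (F.elInv d i)) = fib (F.functor.map φ) i :=
  F.map_fib φ (F.elInv d i)

theorem map_tri {b c d : C} (φ : b ⟶ c) (ψ : c ⟶ d) (θ : b ⟶ d) (h : φ ≫ ψ = θ)
    (h' : F.functor.map φ ≫ F.functor.map ψ = F.functor.map θ) (i : El (F.functor.obj d)) :
    F.functor.map (tri φ ψ θ h (F.elInv d i)) ≍
      tri (F.functor.map φ) (F.functor.map ψ) (F.functor.map θ) h' i :=
  Functor.hcongr_hom (F.R_comp d (F.elInv d i)) (Over.homMk φ h : Over.mk θ ⟶ Over.mk ψ)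

theorem map_trivial {u : C} (hu : IsTrivial u) : IsTrivial (F.functor.obj u) := by
  have i : El u := ⟨⟨0, hu.1.symm ▸ Nat.zero_lt_one⟩⟩
  have h := F.map_fib (𝟙 u) i
  rw [fib_trivial hu, F.functor.map_id] at h
  rw [h]
  exact OperadicCategory.trivial_fib_id _ _

theorem map_fibIncl {c d : C} (ψ : c ⟶ d) (j : El d) (j' : El (F.functor.obj d))
    (hj : j.down.val = j'.down.val) (i : El (fib ψ j)) (i' : El (fib (F.functor.map ψ) j'))
    (hi : i.down.val = i'.down.val) :
    (fibIncl ψ j i).down.val = (fibIncl (F.functor.map ψ) j' i').down.val :=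
  FinS.incl_congr (Functor.congr_obj F.card_comp c).symm (Functor.congr_obj F.card_comp d).symm
    (Functor.hcongr_hom F.card_comp ψ).symm _ _ hj _ _ hi

/-- The function `F²` sending `(x, φ, y)` to `(x, Fφ, y)`. -/
def twoFun {X Y : Over C} (s : TensorEl X Y) :
    TensorEl ((shriek F.functor.obj).obj X) ((shriek F.functor.obj).obj Y) where
  dom := F.functor.obj s.dom
  cod := F.functor.obj s.cod
  φ := F.functor.map s.φ
  x := s.x
  hx := congrArg F.functor.obj s.hx
  y i := s.y (F.elInv s.cod i)
  hy i := (congrArg F.functor.obj (s.hy (F.elInv s.cod i))).trans (F.map_fib' s.φ i)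

/-- The opmonoidal functor `f_! : Coll_C ⥤ Coll_D` induced by a strict operadic functor with
object part `f`. -/
noncomputable def coll : Opmonoidal (Over C) (Over D) where
  functor := shriek F.functor.obj
  two :=
    { app := fun XY => sliceHom (X := (shriek F.functor.obj).obj (collTensorObj XY.1 XY.2))
        (Y := collTensorObj ((shriek F.functor.obj).obj XY.1) ((shriek F.functor.obj).obj XY.2))
        F.twoFun (fun _ => rfl)
      naturality := fun _ _ _ => rfl }
  zero := sliceHom (X := (shriek F.functor.obj).obj (collUnit C)) (Y := collUnit D)
    (fun u => (⟨F.functor.obj u.1, F.map_trivial u.2⟩ : {u : D // IsTrivial u})) (fun _ => rfl)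
  two_α X Y Z := sliceHom_ext fun s => by
    obtain ⟨c, _, φ, t, rfl, z, hz⟩ := s
    refine TensorEl.ext' rfl rfl (heq_of_eq (F.functor.map_comp _ _).symm) rfl fun j j' hj => ?_
    obtain rfl : j = j' := ULift.ext _ _ (Fin.ext hj)
    have h' := (F.functor.map_comp φ (TensorEl.φ t)).symm
    have e1 := (F.map_fib' (φ ≫ TensorEl.φ t) j).symm
    have e2 := (F.map_fib' (TensorEl.φ t) j).symm
    refine TensorEl.ext' ?_ e2 ?_ rfl fun i i' hi => congrArg z (ULift.ext _ _ (Fin.ext ?_))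
    · exact (congrArg (fun f => fib f j) h').trans e1
    · refine HEq.trans ?_ (F.map_tri φ (TensorEl.φ t) (φ ≫ TensorEl.φ t) rfl h' j).symm
      exact tri_congr rfl rfl rfl HEq.rfl HEq.rfl _ _ rfl
    · exact (F.map_fibIncl (TensorEl.φ t) (F.elInv _ j) j rfl (F.elInv _ i') i hi.symm).symm
  two_lam X := sliceHom_ext fun s => rfl
  two_ρ X := sliceHom_ext fun x => by
    refine TensorEl.ext' rfl rfl (heq_of_eq (F.functor.map_id _)) rfl fun j j' hj => ?_
    obtain rfl : j = j' := ULift.ext _ _ (Fin.ext hj)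
    refine Subtype.ext ?_
    refine (F.map_fib' (𝟙 (bd X x)) j).trans ?_
    exact congrArg (fun f => fib f j) (F.functor.map_id _)

end StrictOperadicFunctor

/-- The functor `Coll : OpCat ⥤ SkewMonCat`. -/
noncomputable def Coll : OpCat.{u} ⥤ SkewMonCat.{u, u + 1} where
  obj C := ⟨Over C.carrier⟩
  map F := StrictOperadicFunctor.coll F
  map_id _ := Opmonoidal.eq_of_heq rfl (fun _ _ => HEq.rfl) HEq.rfl
  map_comp _ _ := Opmonoidal.eq_of_heq rfl (fun _ _ => HEq.rfl) HEq.rfl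

/-- The functor `Coll/1 : OpCat ⥤ SkewMonCat/Coll_𝒮` induced by `Coll` and the terminal object `𝒮`
of `OpCat`. -/
noncomputable def CollOver : OpCat.{u} ⥤ Over (Coll.obj OpCat.S.{u}) :=
  Coll.toOver (Coll.obj OpCat.S) (fun C => Coll.map C.toS) (fun {C D} F => by
    rw [← Coll.map_comp, OpCat.toS_unique C (F ≫ D.toS)])

/-! ### The conditions characterizing the image -/

/-- The conditions on an opmonoidal functor `P : E ⥤ Coll_𝒮`, an object of `SkewMonCat/Coll_𝒮`:
the underlying category of `E` is (isomorphic to) a slice category `Set/C`, the underlying functor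
of `P` is (under this isomorphism) `p_! : Set/C ⥤ Set/ℕ` for a function `p : C → ℕ`, and the
naturality squares of `P²` are pullbacks. -/
def IsCollLike : ObjectProperty (Over (Coll.obj OpCat.S.{u})) := fun P =>
  (∃ (C : Type u) (p : C → FinS.{u}) (Φ : P.left.carrier ⥤ Over C) (Ψ : Over C ⥤ P.left.carrier),
    Φ ⋙ Ψ = 𝟭 P.left.carrier ∧ Ψ ⋙ Φ = 𝟭 (Over C) ∧
      Opmonoidal.functor P.hom = Φ ⋙ shriek p) ∧
  NatTrans.Equifibered (Opmonoidal.two P.hom)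

end OpCats

/-!
The idea is that an opmonoidal functor into `Coll_𝒮` whose underlying functor is some `p_!` is a
piece of data about *elements*: to `s ∈ X * Y` it assigns a triple `(x, φ, y)`. Everything that an
operadic category consists of can be written with such triples.

*Fully faithful.* A functor `G` over `Set/ℕ` between slices, `q_! ∘ G = p_!`, does not change the
underlying sets and functions, so it is `f_!` for a unique `f` (`shriek_factor`,
`shriek_obj_injective`). A morphism of `C` is an element of `1 * 1`, where `1 = C` is the terminal
object of `Set/C` (`homEl`), so an opmonoidal functor `P` with underlying functor `f_!` determines
a function on morphisms. Naturality of `P²` along the maps to `1` shows that `P²` sends `(x, φ,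
y)` to `(x, Fφ, y)` for all `X` and `Y`, and compatibility with `α` and `ρ` shows that `F`
preserves composition, identities and the maps between fibres (`exists_coll_eq`).

*The conditions are necessary.* For a strict operadic functor, `F²` is cartesian, since the
naturality maps leave the morphism in `(x, φ, y)` alone and change only `x` and `y`, whereas `F²`
changes only the morphism (`coll_two_equifibered`). If `P` is invertible in `SkewMonCat`, then
`P²` is a natural isomorphism (`two_isIso`), so cartesianness of the second constraint is
invariant under isomorphism.

*The conditions are sufficient.* Let `P : E ⥤ Coll_𝒮` satisfy them, as recorded in `Presentation`.
Cartesianness along the maps to the terminal object `1` says that an element of `X * Y` amounts to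
its *shape*, an element of `1 * 1`, together with suitable elements of `X` and `Y`
(`Presentation.tens_ext`, `Presentation.exists_tens`). The shapes are the morphisms of an operadic
category with set of objects `C`. Elements of `(1 * 1) * 1` are composable pairs of shapes, and
`α` sends such a pair to the composite and to the maps between the fibres; the map `ρ` gives the
identities, and the elements of the unit `U` are the trivial objects. The pentagon gives
associativity, functoriality of the fibres and the double slice condition at once
(`Presentation.pentagon_el`), the axioms on `λ` and `ρ` give the rest. By construction `(x, shape,
y)` defines an opmonoidal functor from `E` to `Coll` of this category, lying over `Coll_𝒮`
(`Presentation.toColl`, `Presentation.toColl_comp`). Its structure maps are bijective and its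
underlying functor is an isomorphism of categories, so it is invertible in `SkewMonCat`
(`opmonoidal_inverse`).

Many equalities hold only after transport along equalities of objects. These are stated as
heterogeneous equalities, or in terms of the natural number that underlies an element of `|c|`.
-/

namespace OpCats

open SkewMonoidal

open scoped Prod

/-! ### Slice categories of sets and the functors `f_!` -/

theorem over_ext {C : Type u} {X Y : Over C} (hl : X.left = Y.left)
    (hb : ∀ (x : X.left) (y : Y.left), x ≍ y → bd X x = bd Y y) : X = Y := by
  obtain ⟨X, ⟨⟨⟩⟩, f⟩ := X
  obtain ⟨Y, ⟨⟨⟩⟩, g⟩ := Y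
  obtain rfl : X = Y := hl
  obtain rfl : f = g := by
    ext x
    exact hb x x HEq.rfl
  rfl

theorem over_hom_heq {C : Type u} {X Y X' Y' : Over C} (hX : X = X') (hY : Y = Y')
    {f : X ⟶ Y} {f' : X' ⟶ Y'}
    (h : ∀ (x : X.left) (x' : X'.left), x ≍ x' → fn f x ≍ fn f' x') : f ≍ f' := by
  subst hX hY
  exact heq_of_eq (sliceHom_ext fun x => eq_of_heq (h x x HEq.rfl))

theorem fn_heq {C : Type u} {X Y X' Y' : Over C} (hX : X = X') (hY : Y = Y')
    {f : X ⟶ Y} {f' : X' ⟶ Y'} (h : f ≍ f') {x : X.left} {x' : X'.left} (hx : x ≍ x') :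
    fn f x ≍ fn f' x' := by
  subst hX hY
  obtain rfl := eq_of_heq h
  obtain rfl := eq_of_heq hx
  rfl

/-- A functor between slice categories that lies strictly over `Set/B` is of the form `f_!`: it
does not change underlying sets and functions, and the value of `f` at `c` is read off from the
one-element set over `c`. -/
theorem shriek_factor {C D B : Type u} (G : Over C ⥤ Over D) (p : C → B) (q : D → B)
    (h : G ⋙ shriek q = shriek p) : ∃ f : C → D, G = shriek f := by
  have hl : ∀ X, (G.obj X).left = X.left := fun X =>
    congrArg (fun Y : Over B => Y.left) (Functor.congr_obj h X)
  have hm : ∀ {X Y : Over C} (g : X ⟶ Y) (y : (G.obj X).left) (x : X.left), y ≍ x →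
      fn (G.map g) y ≍ fn g x := fun {X Y} g y x hyx =>
    fn_heq (Functor.congr_obj h X) (Functor.congr_obj h Y) (Functor.hcongr_hom h g) hyx
  let pt : C → Over C := fun c => sliceMk (fun _ : PUnit.{u + 1} => c)
  have ho : ∀ X, G.obj X =
      (shriek fun c => bd (G.obj (pt c)) (cast (hl _).symm PUnit.unit)).obj X := by
    intro X
    refine over_ext (hl X) fun y x hyx => ?_
    let g : pt (bd X x) ⟶ X := sliceHom (fun _ => x) fun _ => rfl
    refine Eq.trans ?_ (bd_fn (G.map g) _)
    exact congrArg _ (eq_of_heq (hyx.trans (hm g _ PUnit.unit (cast_heq _ _)).symm))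
  exact ⟨_, Functor.hext ho fun X Y g => over_hom_heq (ho X) (ho Y) (hm g)⟩

/-! ### Faithfulness -/

/-- Equal opmonoidal functors into a category of collections send an element to triples with the
same components. -/
theorem two_components {E : Type (u + 1)} [Category.{u} E] [SkewMonoidal E] {B : Type u}
    [SmallCategory B] [OperadicCategory B] {P Q : Opmonoidal E (Over B)} (h : P = Q) (X Y : E)
    (s : (P.functor.obj (tensor.obj (X, Y))).left)
    (s' : (Q.functor.obj (tensor.obj (X, Y))).left) (hs : s ≍ s') :
    let t : TensorEl (P.functor.obj X) (P.functor.obj Y) := fn (P.two.app (X, Y)) s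
    let t' : TensorEl (Q.functor.obj X) (Q.functor.obj Y) := fn (Q.two.app (X, Y)) s'
    t.dom = t'.dom ∧ t.cod = t'.cod ∧ t.φ ≍ t'.φ ∧ t.x ≍ t'.x ∧
      ∀ i j, i.down.val = j.down.val → t.y i ≍ t'.y j := by
  subst h
  obtain rfl := eq_of_heq hs
  refine ⟨rfl, rfl, HEq.rfl, HEq.rfl, fun i j hij => ?_⟩
  obtain rfl : i = j := ULift.ext _ _ (Fin.ext hij)
  rfl

/-- A morphism of `C` as an element of `1 * 1` where `1 = C` is the terminal object of `Set/C`. -/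
def homEl {C : Type u} [SmallCategory C] [OperadicData C] {c d : C} (φ : c ⟶ d) :
    TensorEl (sliceMk (id : C → C)) (sliceMk (id : C → C)) :=
  ⟨c, d, φ, d, rfl, fun i => (fib φ i : C), fun _ => rfl⟩

theorem shriek_obj_injective {C D : Type u} {f g : C → D} (h : shriek f = shriek g) : f = g := by
  funext c
  have h1 := Functor.congr_obj h (sliceMk (fun _ : PUnit.{u + 1} => c))
  have : ∀ (X Y : Over D) (e : X = Y) (x : X.left) (y : Y.left), x ≍ y → bd X x = bd Y y := by
    intro X Y e x y hxy
    subst e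
    rw [eq_of_heq hxy]
  exact this _ _ h1 PUnit.unit PUnit.unit HEq.rfl

theorem collOver_faithful : CollOver.{u}.Faithful where
  map_injective {C D F G} h := by
    have h1 : F.coll = G.coll := congrArg CommaMorphism.left h
    have ho : F.functor.obj = G.functor.obj :=
      shriek_obj_injective (congrArg Opmonoidal.functor h1)
    refine StrictOperadicFunctor.ext (Functor.hext (congrFun ho) fun c d φ => ?_)
    exact (two_components h1 (sliceMk (id : C.carrier → C.carrier)) (sliceMk id) (homEl φ)
      (homEl φ) HEq.rfl).2.2.1

/-! ### The associativity constraint of collections up to transport -/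

section Spec

variable {C : Type u} [SmallCategory C]

/-- A morphism transported along equalities of its domain and its codomain. -/
def homCast {a b a' b' : C} (ha : a = a') (hb : b = b') (φ : a ⟶ b) : a' ⟶ b' :=
  eqToHom ha.symm ≫ φ ≫ eqToHom hb

theorem homCast_heq {a b a' b' : C} (ha : a = a') (hb : b = b') (φ : a ⟶ b) :
    homCast ha hb φ ≍ φ := by
  subst ha hb
  simp [homCast]

theorem comp_heq {a b c a' b' c' : C} {f : a ⟶ b} {g : b ⟶ c} {f' : a' ⟶ b'} {g' : b' ⟶ c'}
    (ha : a = a') (hb : b = b') (hc : c = c') (hf : f ≍ f') (hg : g ≍ g') :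
    f ≫ g ≍ f' ≫ g' := by
  subst ha hb hc
  rw [eq_of_heq hf, eq_of_heq hg]

theorem map_heq {D : Type u} [SmallCategory D] (F : C ⥤ D) {a b a' b' : C} (ha : a = a')
    (hb : b = b') {x : a ⟶ b} {y : a' ⟶ b'} (h : x ≍ y) : F.map x ≍ F.map y := by
  subst ha hb
  rw [eq_of_heq h]

theorem fn_congr {C : Type u} {X Y : Over C} {f g : X ⟶ Y} (h : f = g) (x : X.left) :
    fn f x = fn g x := by
  rw [h]

variable [OperadicCategory C]

/-- The components of `α(t, φ, z)` for `t = (x, ψ, y)`, namely `(x, ψφ, y, φ^ψ, z)`, when `φ` and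
`ψ` are known only up to equalities of their domains and codomains. -/
theorem collAssoc_spec {X Y Z : Over C} (s : TensorEl (collTensorObj X Y) Z) {b c d : C}
    (φ : b ⟶ c) (ψ : c ⟶ d) (t : TensorEl X Y) (ht : s.x = t) (hb : s.dom = b) (hc : s.cod = c)
    (hφ : s.φ ≍ φ) (hd : t.cod = d) (hψ : t.φ ≍ ψ) :
    (collAssocFun s).cod = d ∧ (collAssocFun s).φ ≍ φ ≫ ψ ∧ (collAssocFun s).x = t.x ∧
    ∀ (j : El (collAssocFun s).cod) (j' : El d), j.down.val = j'.down.val →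
      ∀ q : TensorEl Y Z, (collAssocFun s).y j = q →
        q.dom = fib (φ ≫ ψ) j' ∧ q.cod = fib ψ j' ∧ q.φ ≍ tri φ ψ _ rfl j' ∧
        (∀ k : El t.cod, k.down.val = j.down.val → q.x = t.y k) ∧
        ∀ (k : El q.cod) (k' : El (fib ψ j')) (l : El s.cod), k.down.val = k'.down.val →
          l.down.val = (fibIncl ψ j' k').down.val → q.y k = s.y l := by
  obtain ⟨b', c', φ', x, hx, z, hz⟩ := s
  obtain rfl : x = t := ht
  obtain rfl : b' = b := hb
  obtain rfl : c' = c := hc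
  obtain rfl : φ' = φ := eq_of_heq hφ
  obtain ⟨c'', d', ψ', x, hx', y, hy⟩ := x
  obtain rfl : c'' = c' := hx
  obtain rfl : d' = d := hd
  obtain rfl : ψ' = ψ := eq_of_heq hψ
  refine ⟨rfl, HEq.rfl, rfl, ?_⟩
  rintro j j' hj q rfl
  obtain rfl : j = j' := ULift.ext _ _ (Fin.ext hj)
  refine ⟨rfl, rfl, HEq.rfl, ?_, ?_⟩
  · intro k hk
    obtain rfl : k = j := ULift.ext _ _ (Fin.ext hk)
    rfl
  · intro k k' l hk hl
    obtain rfl : k = k' := ULift.ext _ _ (Fin.ext hk)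
    obtain rfl : l = fibIncl ψ' j k := ULift.ext _ _ (Fin.ext hl)
    rfl

end Spec

/-! ### Fullness -/

section Full

variable {C D : Type u} [SmallCategory C] [SmallCategory D] [OperadicCategory C]
  [OperadicCategory D]

/-- An opmonoidal functor over `Coll_𝒮` whose underlying functor is `f_!` comes from a strict
operadic functor with object part `f`. -/
theorem exists_coll_eq (f : C → D) (P : Opmonoidal (Over C) (Over D)) (hP : P.functor = shriek f)
    (h : P.comp (OpCat.toS ⟨D⟩).coll = (OpCat.toS ⟨C⟩).coll) :
    ∃ F : StrictOperadicFunctor C D, F.coll = P := by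
  obtain ⟨G, two, zero, two_α, two_lam, two_ρ⟩ := P
  obtain rfl : G = shriek f := hP
  let G2 : ∀ {X Y : Over C}, TensorEl X Y → TensorEl ((shriek f).obj X) ((shriek f).obj Y) :=
    fun {X Y} s => fn (two.app (X, Y)) s
  have dom : ∀ {X Y : Over C} (s : TensorEl X Y), (G2 s).dom = f s.dom := fun {X Y} s =>
    bd_fn (two.app (X, Y)) s
  have comps := fun {X Y : Over C} (s : TensorEl X Y) => two_components h X Y s s HEq.rfl
  have hx : ∀ {X Y : Over C} (s : TensorEl X Y), (G2 s).x = s.x := fun s =>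
    eq_of_heq (comps s).2.2.2.1
  have cod : ∀ {X Y : Over C} (s : TensorEl X Y), (G2 s).cod = f s.cod := fun {X Y} s =>
    (G2 s).hx.symm.trans ((congrArg (fun t => f (bd X t)) (hx s)).trans (congrArg f s.hx))
  have hy : ∀ {X Y : Over C} (s : TensorEl X Y) i j, i.down.val = j.down.val →
      (G2 s).y i = s.y j := fun s i j hij => eq_of_heq ((comps s).2.2.2.2 i j hij)
  have hcard : ∀ {X Y : Over C} (s : TensorEl X Y),
      OperadicData.card.map (G2 s).φ ≍ OperadicData.card.map s.φ := fun s => (comps s).2.2.1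
  -- The morphism part of the operadic functor, given by the elements of `1 * 1`.
  let m : ∀ {c d : C}, (c ⟶ d) → (f c ⟶ f d) := fun {c d} φ =>
    homCast (dom (homEl φ)) (cod (homEl φ)) (G2 (homEl φ)).φ
  -- By naturality along the maps `X ⟶ 1` and `Y ⟶ 1` it computes the second component in general.
  have hm : ∀ {X Y : Over C} (s : TensorEl X Y), (G2 s).φ ≍ m s.φ := by
    intro X Y s
    refine HEq.trans ?_ (homCast_heq (dom (homEl s.φ)) (cod (homEl s.φ)) (G2 (homEl s.φ)).φ).symm
    let a : X ⟶ sliceMk (id : C → C) := sliceHom (bd X) fun _ => rfl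
    let b : Y ⟶ sliceMk (id : C → C) := sliceHom (bd Y) fun _ => rfl
    have h1 : fn (collTensorMap a b) s = homEl s.φ := by
      refine TensorEl.ext' rfl rfl HEq.rfl s.hx fun i j hij => ?_
      obtain rfl : i = j := ULift.ext _ _ (Fin.ext hij)
      exact s.hy i
    have h2 : fn (collTensorMap ((shriek f).map a) ((shriek f).map b)) (G2 s) =
        G2 (fn (collTensorMap a b) s) :=
      (fn_congr (two.naturality (X := (X, Y))
        (Y := (sliceMk (id : C → C), sliceMk (id : C → C))) (a, b)) s).symm
    rw [h1] at h2
    rw [← h2]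
    rfl
  have hfib : ∀ {c d : C} (φ : c ⟶ d) (i : El d) (j : El (f d)), i.down.val = j.down.val →
      f (fib φ i) = fib (m φ) j := by
    intro c d φ i j hij
    let k : El (G2 (homEl φ)).cod := Idx.cast (congrArg _ (cod (homEl φ)).symm) j
    have h1 := (G2 (homEl φ)).hy k
    rw [hy (homEl φ) k i hij.symm] at h1
    refine h1.trans ?_
    exact fib_congr (dom (homEl φ)) (cod (homEl φ)) (homCast_heq _ _ _).symm _ _ rfl
  -- Compatibility with `α` for the element of `(1 * 1) * 1` given by a composable pair.
  have hα : ∀ {b c d : C} (φ : b ⟶ c) (ψ : c ⟶ d), m (φ ≫ ψ) = m φ ≫ m ψ ∧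
      ∀ (j : El d) (j' : El (f d)), j.down.val = j'.down.val →
        m (tri φ ψ _ rfl j) ≍ tri (m φ) (m ψ) _ rfl j' := by
    intro b c d φ ψ
    let I : Over C := sliceMk (id : C → C)
    let s : TensorEl (collTensorObj I I) I :=
      ⟨b, c, φ, homEl ψ, rfl, fun i => (fib φ i : C), fun _ => rfl⟩
    let u : TensorEl (collTensorObj ((shriek f).obj I) ((shriek f).obj I)) ((shriek f).obj I) :=
      fn (collTensorMap (two.app (I, I)) (𝟙 _)) (G2 s)
    have e : collAssocFun u = fn (collTensorMap (𝟙 _) (two.app (I, I))) (G2 (collAssocFun s)) :=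
      fn_congr (two_α I I I) s
    have hu : u.x = G2 (homEl ψ) := congrArg G2 (hx s)
    obtain ⟨-, h2, -, h4⟩ := collAssoc_spec u (m φ) (m ψ) _ hu (dom s) (cod s) (hm s)
      (cod (homEl ψ)) (hm (homEl ψ))
    rw [e] at h2 h4
    refine ⟨eq_of_heq ((hm (collAssocFun s)).symm.trans h2), fun j j' hj => ?_⟩
    let k : El (G2 (collAssocFun s)).cod :=
      Idx.cast (congrArg _ (cod (collAssocFun s)).symm) j'
    have h5 := (h4 k j' rfl _ rfl).2.2.1
    refine HEq.trans ?_ h5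
    have h6 : (G2 (collAssocFun s)).y k = (collAssocFun s).y j := hy _ k j hj.symm
    have h7 : fn (two.app (I, I)) ((G2 (collAssocFun s)).y k) = G2 ((collAssocFun s).y j) :=
      congrArg G2 h6
    refine (hm ((collAssocFun s).y j)).symm.trans ?_
    rw [← h7]
    rfl
  have hobj : (fun c => OperadicData.card.obj (f c)) = fun c : C => OperadicData.card.obj c :=
    shriek_obj_injective (congrArg Opmonoidal.functor h)
  have hα' : ∀ {b c d : C} (φ : b ⟶ c) (ψ : c ⟶ d) (θ : b ⟶ d) (h : φ ≫ ψ = θ) (j : El d)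
      (j' : El (f d)), j.down.val = j'.down.val → m (tri φ ψ θ h j) ≍
        tri (m φ) (m ψ) (m θ) ((hα φ ψ).1.symm.trans (congrArg m h)) j' := by
    rintro b c d φ ψ _ rfl j j' hj
    exact ((hα φ ψ).2 j j' hj).trans (tri_congr rfl rfl rfl HEq.rfl HEq.rfl _ _ rfl)
  let F : StrictOperadicFunctor C D :=
    { functor :=
        { obj := f
          map := m
          map_id := fun c => by
            let I : Over C := sliceMk (id : C → C)
            have e1 : fn (collTensorMap (𝟙 _) zero) (G2 (collRhoFun (X := I) c)) =
              collRhoFun (X := (shriek f).obj I) c := fn_congr (two_ρ I) c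
            have e2 : (fn (collTensorMap (𝟙 _) zero) (G2 (collRhoFun (X := I) c))).φ ≍
              (collRhoFun (X := (shriek f).obj I) c).φ := by rw [e1]
            exact eq_of_heq ((hm (collRhoFun (X := I) c)).symm.trans e2)
          map_comp := fun φ ψ => (hα φ ψ).1 }
      card_comp := Functor.hext
        (congrFun hobj) fun c d φ => (map_heq OperadicData.card (dom (homEl φ)).symm
          (cod (homEl φ)).symm (homCast_heq (dom (homEl φ)) (cod (homEl φ)) _)).trans
            (hcard (homEl φ))
      R_comp := fun c i => Functor.hext
        (fun ψ => hfib ψ.hom i (Idx.cast (congrFun hobj c).symm i) rfl) fun θ ψ a => by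
          exact hα' a.left ψ.hom θ.hom (Over.w a) i (Idx.cast (congrFun hobj c).symm i) rfl }
  refine ⟨F, Opmonoidal.eq_of_heq rfl (fun X Y => heq_of_eq (sliceHom_ext fun s => ?_))
    (heq_of_eq (sliceHom_ext fun s => Subtype.ext ?_))⟩
  · exact (TensorEl.ext' (dom s) (cod s) (hm s) (hx s) fun i j hij => hy s i _ hij).symm
  · exact (bd_fn zero s).symm

end Full

theorem collOver_full : CollOver.{u}.Full where
  map_surjective {C D} g := by
    have hw : Opmonoidal.comp g.left (OpCat.toS D).coll = (OpCat.toS C).coll := Over.w g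
    obtain ⟨f, hf⟩ := shriek_factor _ _ _ (congrArg Opmonoidal.functor hw)
    obtain ⟨F, hF⟩ := exists_coll_eq f g.left hf hw
    exact ⟨F, Over.OverMorphism.ext hF⟩

/-! ### Pullbacks in slice categories of sets -/

section Pullback

theorem isPullback_of_existsUnique {D : Type u} {A B B' Z : Over D} {a : A ⟶ B} {a' : A ⟶ B'}
    {f : B ⟶ Z} {g : B' ⟶ Z} (w : a ≫ f = a' ≫ g)
    (h : ∀ b b', fn f b = fn g b' → ∃! s, fn a s = b ∧ fn a' s = b') : IsPullback a a' f g := by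
  refine ⟨⟨w⟩, ⟨Limits.PullbackCone.IsLimit.mk w
    (fun c => sliceHom (fun x => (h (fn c.fst x) (fn c.snd x) (fn_congr c.condition x)).choose)
      fun x => ?_) (fun c => sliceHom_ext fun x => ?_) (fun c => sliceHom_ext fun x => ?_)
      (fun c m h1 h2 => sliceHom_ext fun x => ?_)⟩⟩
  · have h1 := (h (fn c.fst x) (fn c.snd x) (fn_congr c.condition x)).choose_spec.1.1
    exact (bd_fn a _).symm.trans ((congrArg (bd B) h1).trans (bd_fn c.fst x))
  · exact (h (fn c.fst x) (fn c.snd x) (fn_congr c.condition x)).choose_spec.1.1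
  · exact (h (fn c.fst x) (fn c.snd x) (fn_congr c.condition x)).choose_spec.1.2
  · exact (h (fn c.fst x) (fn c.snd x) (fn_congr c.condition x)).choose_spec.2 _
      ⟨fn_congr h1 x, fn_congr h2 x⟩

theorem existsUnique_of_isPullback {D : Type u} {A B B' Z : Over D} {a : A ⟶ B} {a' : A ⟶ B'}
    {f : B ⟶ Z} {g : B' ⟶ Z} (h : IsPullback a a' f g) (b : B.left) (b' : B'.left)
    (hb : fn f b = fn g b') : ∃! s, fn a s = b ∧ fn a' s = b' := by
  have hd : bd B' b' = bd B b := by rw [← bd_fn f, ← bd_fn g, hb]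
  let T : Over D := sliceMk (fun _ : PUnit.{u + 1} => bd B b)
  let t : T ⟶ B := sliceHom (fun _ => b) fun _ => rfl
  let t' : T ⟶ B' := sliceHom (fun _ => b') fun _ => hd
  have ht : t ≫ f = t' ≫ g := sliceHom_ext fun _ => hb
  refine ⟨fn (h.lift t t' ht) PUnit.unit, ⟨fn_congr (h.lift_fst t t' ht) PUnit.unit,
    fn_congr (h.lift_snd t t' ht) PUnit.unit⟩, ?_⟩
  rintro s ⟨h1, h2⟩
  have hs : bd A s = bd B b := by rw [← h1, bd_fn]
  let m : T ⟶ A := sliceHom (fun _ => s) fun _ => hs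
  have : m = h.lift t t' ht := by
    apply h.hom_ext
    · rw [h.lift_fst]
      exact sliceHom_ext fun _ => h1
    · rw [h.lift_snd]
      exact sliceHom_ext fun _ => h2
  exact fn_congr this PUnit.unit

theorem isIso_of_bijective {C : Type u} {X Y : Over C} (f : X ⟶ Y)
    (h : Function.Bijective (fn f)) : IsIso f := by
  choose g hg using h.2
  refine ⟨sliceHom g fun y => ?_, sliceHom_ext fun x => h.1 (hg (fn f x)), sliceHom_ext hg⟩
  rw [← bd_fn f, hg]

end Pullback

/-! ### Necessity of the conditions -/

/-- The natural transformation `F²` is cartesian: an element `(x, φ, y)` and an element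
`(x', φ', y')` with the same image come from a unique element, which has the morphism `φ` and the
components `x'` and `y'`. -/
theorem coll_two_equifibered {C D : Type u} [SmallCategory C] [SmallCategory D]
    [OperadicCategory C] [OperadicCategory D] (F : StrictOperadicFunctor C D) :
    NatTrans.Equifibered F.coll.two := by
  rintro ⟨X, Y⟩ ⟨X', Y'⟩ f
  refine isPullback_of_existsUnique (F.coll.two.naturality f) fun (s : TensorEl X' Y') t ht => ?_
  change TensorEl ((shriek F.functor.obj).obj X) ((shriek F.functor.obj).obj Y) at t
  change F.twoFun s = fn (collTensorMap ((shriek F.functor.obj).map f.1)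
    ((shriek F.functor.obj).map f.2)) t at ht
  obtain ⟨c, d, φ, x, hx, y, hy⟩ := s
  obtain ⟨c', d', φ', x', hx', y', hy'⟩ := t
  obtain rfl : F.functor.obj c = c' := congrArg TensorEl.dom ht
  obtain rfl : F.functor.obj d = d' := congrArg TensorEl.cod ht
  obtain ⟨-, -, h1, h2, h3⟩ := TensorEl.mk.inj ht
  obtain rfl : F.functor.map φ = φ' := eq_of_heq h1
  obtain rfl : x = fn f.1 x' := h2
  have h4 : ∀ i, y (F.elInv d i) = fn f.2 (y' i) := congrFun (eq_of_heq h3)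
  refine ⟨(⟨c, d, φ, x', (bd_fn f.1 x').symm.trans hx, fun i => y' (F.elMap d i), fun i => ?_⟩ :
    TensorEl X Y), ⟨?_, rfl⟩, ?_⟩
  · exact (bd_fn f.2 _).symm.trans ((congrArg (bd Y') (h4 _).symm).trans (hy _))
  · refine TensorEl.ext' rfl rfl HEq.rfl rfl fun i j hij => ?_
    obtain rfl : i = j := ULift.ext _ _ (Fin.ext hij)
    exact (h4 (F.elMap d i)).symm
  · rintro ⟨c₁, d₁, φ₁, x₁, hx₁, y₁, hy₁⟩ ⟨h5, h6⟩
    have h5 := TensorEl.mk.inj h5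
    have h6 := TensorEl.mk.inj h6
    obtain rfl : c₁ = c := h5.1
    obtain rfl : d₁ = d := h5.2.1
    refine TensorEl.ext' rfl rfl h5.2.2.1 h6.2.2.2.1 fun i j hij => ?_
    obtain rfl : i = j := ULift.ext _ _ (Fin.ext hij)
    exact congrFun (eq_of_heq h6.2.2.2.2) (F.elMap d₁ i)

section Transport

variable {A B : Type w} [Category.{v} A] [Category.{v} B]

theorem isIso_of_heq {a b a' b' : A} {f : a ⟶ b} {g : a' ⟶ b'}
    (ha : a = a') (hb : b = b') (h : f ≍ g) (hg : IsIso g) : IsIso f := by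
  subst ha hb
  rwa [eq_of_heq h]

theorem isIso_of_map {G : A ⥤ B} {G' : B ⥤ A} (h : G ⋙ G' = 𝟭 A) {X Y : A} (f : X ⟶ Y)
    (hf : IsIso (G.map f)) : IsIso f :=
  isIso_of_heq (Functor.congr_obj h X).symm (Functor.congr_obj h Y).symm
    (Functor.hcongr_hom h f).symm (inferInstanceAs (IsIso (G'.map (G.map f))))

theorem eqToHom_heq_id {X Y Z : A} (h : X = Y) (h' : X = Z) : eqToHom h ≍ 𝟙 Z := by
  subst h h'
  rfl

end Transport

section Inverse

variable {E F : Type w} [Category.{v} E] [SkewMonoidal E] [Category.{v} F] [SkewMonoidal F]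

theorem two_heq {P Q : Opmonoidal E F} (h : P = Q) (X Y : E) :
    P.two.app (X, Y) ≍ Q.two.app (X, Y) := by
  rw [h]

theorem comp_two_isIso {P : Opmonoidal E F} {Q : Opmonoidal F E} (h : P.comp Q = Opmonoidal.id E)
    (X Y : E) : IsIso (Q.functor.map (P.two.app (X, Y)) ≫
      Q.two.app (P.functor.obj X, P.functor.obj Y)) := by
  have hf : P.functor ⋙ Q.functor = 𝟭 E := congrArg Opmonoidal.functor h
  have hX := Functor.congr_obj hf X
  have hY := Functor.congr_obj hf Y
  have hXY := Functor.congr_obj hf (tensor.obj (X, Y))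
  dsimp at hX hY hXY
  refine isIso_of_heq hXY ?_ (two_heq h X Y) (inferInstanceAs (IsIso (𝟙 _)))
  change tensor.obj (_, _) = tensor.obj (X, Y)
  rw [hX, hY]

/-- The map `P²` of an invertible opmonoidal functor is invertible. If `Q` is the inverse, then both
`Q(P²)` followed by `Q²` and `P(Q²)` followed by `P²` are invertible. Hence `P(Q²)` is a split
epimorphism and a monomorphism, so it is invertible, and then so are `Q²` and `P²`. -/
theorem two_isIso {P : Opmonoidal E F} {Q : Opmonoidal F E} (h : P.comp Q = Opmonoidal.id E)
    (h' : Q.comp P = Opmonoidal.id F) (X Y : E) : IsIso (P.two.app (X, Y)) := by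
  have hf : P.functor ⋙ Q.functor = 𝟭 E := congrArg Opmonoidal.functor h
  have hf' : Q.functor ⋙ P.functor = 𝟭 F := congrArg Opmonoidal.functor h'
  have h1 := comp_two_isIso h X Y
  have h2 := comp_two_isIso h' (P.functor.obj X) (P.functor.obj Y)
  have h3 : IsIso (P.functor.map (Q.functor.map (P.two.app (X, Y))) ≫
      P.functor.map (Q.two.app (P.functor.obj X, P.functor.obj Y))) := by
    rw [← Functor.map_comp]
    infer_instance
  have h4 : IsIso (P.functor.map (Q.two.app (P.functor.obj X, P.functor.obj Y))) := by
    have := mono_of_mono (P.functor.map (Q.two.app (P.functor.obj X, P.functor.obj Y)))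
      (P.two.app (Q.functor.obj (P.functor.obj X), Q.functor.obj (P.functor.obj Y)))
    have : IsSplitEpi (P.functor.map (Q.two.app (P.functor.obj X, P.functor.obj Y))) :=
      ⟨⟨inv (P.functor.map (Q.functor.map (P.two.app (X, Y))) ≫
        P.functor.map (Q.two.app (P.functor.obj X, P.functor.obj Y))) ≫
        P.functor.map (Q.functor.map (P.two.app (X, Y))), by simp⟩⟩
    exact isIso_of_mono_of_isSplitEpi _
  have h5 := isIso_of_map hf _ h4
  have h6 : IsIso (Q.functor.map (P.two.app (X, Y))) := IsIso.of_isIso_comp_right _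
    (Q.two.app (P.functor.obj X, P.functor.obj Y))
  exact isIso_of_map hf' _ h6

theorem comp_two_equifibered {G : Type w} [Category.{v} G] [SkewMonoidal G] (P : Opmonoidal E F)
    (Q : Opmonoidal F G) (hP : ∀ X Y, IsIso (P.two.app (X, Y)))
    (hQ : NatTrans.Equifibered Q.two) : NatTrans.Equifibered (P.comp Q).two := by
  rintro ⟨X, Y⟩ ⟨X', Y'⟩ f
  have i1 := hP X Y
  have i2 := hP X' Y'
  have j1 : IsIso (Q.functor.map (P.two.app (X, Y))) := inferInstance
  have j2 : IsIso (Q.functor.map (P.two.app (X', Y'))) := inferInstance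
  have hn := congrArg Q.functor.map (P.two.naturality f)
  rw [Functor.map_comp, Functor.map_comp] at hn
  exact (IsPullback.of_vert_isIso ⟨hn⟩).paste_vert (hQ ((P.functor.prod P.functor).map f))

end Inverse

theorem isCollLike_of_essImage (P : Over (Coll.obj OpCat.S.{u})) (h : CollOver.essImage P) :
    IsCollLike P := by
  obtain ⟨C, ⟨i⟩⟩ := h
  have h1 : Opmonoidal.comp i.inv.left i.hom.left = Opmonoidal.id P.left.carrier :=
    congrArg CommaMorphism.left i.inv_hom_id
  have h2 : Opmonoidal.comp i.hom.left i.inv.left = Opmonoidal.id (Over C.carrier) :=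
    congrArg CommaMorphism.left i.hom_inv_id
  have hw : Opmonoidal.comp i.inv.left C.toS.coll = P.hom := Over.w i.inv
  refine ⟨⟨C.carrier, OperadicData.card.obj, Opmonoidal.functor i.inv.left,
    Opmonoidal.functor i.hom.left, congrArg Opmonoidal.functor h1,
    congrArg Opmonoidal.functor h2, (congrArg Opmonoidal.functor hw).symm⟩, ?_⟩
  rw [← hw]
  exact comp_two_equifibered _ _ (two_isIso h1 h2) (coll_two_equifibered C.toS)

/-! ### Inverses of opmonoidal functors -/

section Inverse

variable {E F : Type w} [Category.{v} E] [SkewMonoidal E] [Category.{v} F] [SkewMonoidal F]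

theorem tensor_map_eqToHom {X X' Y Y' : E} (h : X = X') (h' : Y = Y') :
    tensor.map (eqToHom h ×ₘ eqToHom h') = eqToHom (by rw [h, h']) := by
  subst h h'
  exact tensor.map_id _

theorem tensor_map_isIso {X X' Y Y' : E} (f : X ⟶ X') (g : Y ⟶ Y') [IsIso f] [IsIso g] :
    IsIso (tensor.map (f ×ₘ g)) := by
  have : IsIso (f ×ₘ g) := ⟨inv f ×ₘ inv g, by ext <;> simp, by ext <;> simp⟩
  infer_instance

/-- The functoriality of the tensor product, oriented so that simplification merges composites. -/
theorem tensor_comp {X X' X'' Y Y' Y'' : E} (f : X ⟶ X') (f' : X' ⟶ X'') (g : Y ⟶ Y')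
    (g' : Y' ⟶ Y'') : tensor.map (f ×ₘ g) ≫ tensor.map (f' ×ₘ g') =
      tensor.map ((f ≫ f') ×ₘ (g ≫ g')) :=
  (tensor_map_comp f f' g g').symm

theorem tensor_comp_assoc {X X' X'' Y Y' Y'' Z : E} (f : X ⟶ X') (f' : X' ⟶ X'') (g : Y ⟶ Y')
    (g' : Y' ⟶ Y'') (k : tensor.obj (X'', Y'') ⟶ Z) :
    tensor.map (f ×ₘ g) ≫ tensor.map (f' ×ₘ g') ≫ k =
      tensor.map ((f ≫ f') ×ₘ (g ≫ g')) ≫ k := by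
  rw [tensor_map_comp, Category.assoc]

/-- An opmonoidal functor with invertible structure maps, whose underlying functor is strictly
invertible, is strictly invertible as an opmonoidal functor. The inverse has as structure maps the
mates of the inverses of those of `P`. -/
theorem opmonoidal_inverse (P : Opmonoidal E F) (Ψ : F ⥤ E) (h : P.functor ⋙ Ψ = 𝟭 E)
    (h' : Ψ ⋙ P.functor = 𝟭 F) (h2 : ∀ X Y, IsIso (P.two.app (X, Y))) (h0 : IsIso P.zero) :
    ∃ Q : Opmonoidal F E, P.comp Q = Opmonoidal.id E ∧ Q.comp P = Opmonoidal.id F := by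
  let e := CategoryTheory.Equivalence.mk P.functor Ψ (eqToIso h.symm) (eqToIso h')
  have full : P.functor.Full := e.full_functor
  have faithful : P.functor.Faithful := e.faithful_functor
  have ho : ∀ X, P.functor.obj (Ψ.obj X) = X := Functor.congr_obj h'
  have ho' : ∀ X, Ψ.obj (P.functor.obj X) = X := Functor.congr_obj h
  have ε_nat : ∀ {X Y : F} (f : X ⟶ Y), P.functor.map (Ψ.map f) ≫ eqToHom (ho Y) =
      eqToHom (ho X) ≫ f := by
    intro X Y f
    have := Functor.congr_hom h' f
    dsimp at this
    rw [this]
    simp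
  have P_nat : ∀ {X X' Y Y' : E} (f : X ⟶ X') (g : Y ⟶ Y'),
      P.functor.map (tensor.map (f ×ₘ g)) ≫ P.two.app (X', Y') =
        P.two.app (X, Y) ≫ tensor.map (P.functor.map f ×ₘ P.functor.map g) := fun f g =>
    P.two.naturality (f ×ₘ g)
  have ht : ∀ X Y : F, ∃ t : Ψ.obj (tensor.obj (X, Y)) ⟶ tensor.obj (Ψ.obj X, Ψ.obj Y),
      P.functor.map t ≫ P.two.app (Ψ.obj X, Ψ.obj Y) ≫
        tensor.map (eqToHom (ho X) ×ₘ eqToHom (ho Y)) = eqToHom (ho _) := by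
    intro X Y
    have := h2 (Ψ.obj X) (Ψ.obj Y)
    have := tensor_map_isIso (eqToHom (ho X)) (eqToHom (ho Y))
    refine ⟨P.functor.preimage (eqToHom (ho _) ≫ inv (P.two.app (Ψ.obj X, Ψ.obj Y) ≫
      tensor.map (eqToHom (ho X) ×ₘ eqToHom (ho Y)))), ?_⟩
    rw [P.functor.map_preimage, Category.assoc, IsIso.inv_hom_id, Category.comp_id]
  choose t ht using ht
  obtain ⟨z, hz⟩ : ∃ z : Ψ.obj unit ⟶ unit, P.functor.map z ≫ P.zero = eqToHom (ho _) :=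
    ⟨P.functor.preimage (eqToHom (ho _) ≫ inv P.zero), by simp⟩
  have cancel : ∀ {W : E} {X Y : F} {f g : W ⟶ tensor.obj (Ψ.obj X, Ψ.obj Y)},
      P.functor.map f ≫ P.two.app (Ψ.obj X, Ψ.obj Y) ≫
        tensor.map (eqToHom (ho X) ×ₘ eqToHom (ho Y)) =
      P.functor.map g ≫ P.two.app (Ψ.obj X, Ψ.obj Y) ≫
        tensor.map (eqToHom (ho X) ×ₘ eqToHom (ho Y)) → f = g := by
    intro W X Y f g hfg
    have := h2 (Ψ.obj X) (Ψ.obj Y)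
    have := tensor_map_isIso (eqToHom (ho X)) (eqToHom (ho Y))
    exact P.functor.map_injective ((cancel_mono _).1 hfg)
  -- Since `P` is faithful, each axiom for `Q` may be checked after applying `P` and composing with
  -- the invertible structure maps of `P`, where it turns into the axiom for `P`.
  let Q : Opmonoidal F E :=
    { functor := Ψ
      two :=
        { app := fun XY => t XY.1 XY.2
          naturality := by
            rintro ⟨X, Y⟩ ⟨X', Y'⟩ ⟨f, g⟩
            apply cancel
            change P.functor.map (Ψ.map (tensor.map (f ×ₘ g)) ≫ t X' Y') ≫ _ =
              P.functor.map (t X Y ≫ tensor.map (Ψ.map f ×ₘ Ψ.map g)) ≫ _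
            rw [Functor.map_comp, Functor.map_comp, Category.assoc, Category.assoc, ht,
              reassoc_of% (P_nat (Ψ.map f) (Ψ.map g)), ← tensor_map_comp, ε_nat, ε_nat, ε_nat,
              tensor_map_comp, reassoc_of% (ht X Y)] }
      zero := z
      two_α := fun X Y Z => by
        have i1 := h2 (Ψ.obj X) (tensor.obj (Ψ.obj Y, Ψ.obj Z))
        have i2 := h2 (Ψ.obj Y) (Ψ.obj Z)
        have i3 := tensor_map_isIso (𝟙 (P.functor.obj (Ψ.obj X))) (P.two.app (Ψ.obj Y, Ψ.obj Z))
        have i4 := tensor_map_isIso (eqToHom (ho Y)) (eqToHom (ho Z))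
        have i5 := tensor_map_isIso (eqToHom (ho X))
          (tensor.map (eqToHom (ho Y) ×ₘ eqToHom (ho Z)))
        apply P.functor.map_injective
        rw [← cancel_mono (P.two.app (Ψ.obj X, tensor.obj (Ψ.obj Y, Ψ.obj Z))),
          ← cancel_mono (tensor.map (𝟙 (P.functor.obj (Ψ.obj X)) ×ₘ P.two.app (Ψ.obj Y, Ψ.obj Z))),
          ← cancel_mono (tensor.map (eqToHom (ho X) ×ₘ
            tensor.map (eqToHom (ho Y) ×ₘ eqToHom (ho Z))))]
        simp only [Functor.map_comp, Category.assoc]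
        have a := P.two_α (Ψ.obj X) (Ψ.obj Y) (Ψ.obj Z)
        have n1 := P_nat (t X Y) (𝟙 (Ψ.obj Z))
        have n2 := P_nat (𝟙 (Ψ.obj X)) (t Y Z)
        have n3 := α_naturality (eqToHom (ho X)) (eqToHom (ho Y)) (eqToHom (ho Z))
        rw [CategoryTheory.Functor.map_id] at n1 n2
        rw [reassoc_of% a.symm, ← n3, reassoc_of% n1, reassoc_of% n2]
        simp only [tensor_comp, tensor_comp_assoc, Category.id_comp, ht]
        rw [reassoc_of% (ht (tensor.obj (X, Y)) Z), ε_nat]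
      two_lam := fun X => by
        apply P.functor.map_injective
        rw [← cancel_mono (eqToHom (ho X))]
        simp only [Functor.map_comp, Category.assoc]
        have n1 := P_nat z (𝟙 (Ψ.obj X))
        rw [CategoryTheory.Functor.map_id] at n1
        rw [← P.two_lam, Category.assoc, Category.assoc, reassoc_of% n1,
          ← lam_naturality (eqToHom (ho X))]
        simp only [tensor_comp_assoc, Category.id_comp, Category.comp_id, hz]
        rw [reassoc_of% (ht unit X), ε_nat]
      two_ρ := fun X => by
        have i1 := h2 (Ψ.obj X) unit
        have i2 := tensor_map_isIso (eqToHom (ho X)) P.zero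
        apply P.functor.map_injective
        rw [← cancel_mono (P.two.app (Ψ.obj X, unit)),
          ← cancel_mono (tensor.map (eqToHom (ho X) ×ₘ P.zero))]
        simp only [Functor.map_comp, Category.assoc]
        have n1 := P_nat (𝟙 (Ψ.obj X)) z
        rw [CategoryTheory.Functor.map_id] at n1
        have a := congrArg (· ≫ tensor.map (eqToHom (ho X) ×ₘ 𝟙 unit)) (P.two_ρ (Ψ.obj X))
        simp only [Category.assoc, tensor_comp, Category.id_comp, Category.comp_id] at a
        rw [reassoc_of% n1, a, ← ρ_naturality]
        simp only [tensor_comp, Category.id_comp, hz]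
        rw [ht, ε_nat] }
  refine ⟨Q, Opmonoidal.eq_of_heq h (fun X Y => ?_) ?_,
    Opmonoidal.eq_of_heq h' (fun X Y => ?_) ?_⟩
  · have hXY : Ψ.obj (P.functor.obj (tensor.obj (X, Y))) = tensor.obj
        (Ψ.obj (P.functor.obj X), Ψ.obj (P.functor.obj Y)) := by
      rw [ho', ho', ho']
    have : Ψ.map (P.two.app (X, Y)) ≫ t (P.functor.obj X) (P.functor.obj Y) = eqToHom hXY := by
      have e1 : eqToHom hXY = eqToHom (ho' _) ≫
          tensor.map (eqToHom (ho' X).symm ×ₘ eqToHom (ho' Y).symm) := by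
        rw [tensor_map_eqToHom, eqToHom_trans]
      apply cancel
      rw [e1, Functor.map_comp, Functor.map_comp, Category.assoc, Category.assoc, ht, ε_nat,
        reassoc_of% (P_nat (eqToHom (ho' X).symm) (eqToHom (ho' Y).symm)), tensor_comp,
        eqToHom_map, eqToHom_map, eqToHom_map, eqToHom_trans, eqToHom_trans, eqToHom_refl,
        eqToHom_refl]
      exact congrArg _ ((Category.comp_id _).symm.trans (congrArg _ (tensor.map_id _).symm))
    change Ψ.map (P.two.app (X, Y)) ≫ t (P.functor.obj X) (P.functor.obj Y) ≍ 𝟙 _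
    rw [this]
    exact eqToHom_heq_id _ (ho' _)
  · have : Ψ.map P.zero ≫ z = eqToHom (ho' _) := by
      apply P.functor.map_injective
      rw [← cancel_mono P.zero, Functor.map_comp, Category.assoc, hz, ε_nat, eqToHom_map]
    change Ψ.map P.zero ≫ z ≍ 𝟙 _
    rw [this]
    exact eqToHom_heq_id _ (ho' _)
  · have i := tensor_map_isIso (eqToHom (ho X)) (eqToHom (ho Y))
    have hXY : P.functor.obj (Ψ.obj (tensor.obj (X, Y))) = tensor.obj
        (P.functor.obj (Ψ.obj X), P.functor.obj (Ψ.obj Y)) := by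
      rw [ho, ho, ho]
    have : P.functor.map (t X Y) ≫ P.two.app (Ψ.obj X, Ψ.obj Y) = eqToHom hXY := by
      rw [← cancel_mono (tensor.map (eqToHom (ho X) ×ₘ eqToHom (ho Y))), Category.assoc, ht,
        tensor_map_eqToHom, eqToHom_trans]
    change P.functor.map (t X Y) ≫ P.two.app (Ψ.obj X, Ψ.obj Y) ≍ 𝟙 _
    rw [this]
    exact eqToHom_heq_id _ (ho _)
  · change P.functor.map z ≫ P.zero ≍ 𝟙 _
    rw [hz]
    exact eqToHom_heq_id _ (ho _)

end Inverse

/-! ### Elements of tensor products -/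

theorem FinS.fibMap_congr {a b c a' b' c' : FinS.{u}} {φ : a ⟶ b} {ψ : b ⟶ c} {θ : a ⟶ c}
    {φ' : a' ⟶ b'} {ψ' : b' ⟶ c'} {θ' : a' ⟶ c'} (ha : a = a') (hb : b = b') (hc : c = c')
    (hφ : φ ≍ φ') (hψ : ψ ≍ ψ') (h : φ ≫ ψ = θ) (h' : φ' ≫ ψ' = θ') (i : Idx c) (i' : Idx c')
    (hi : i.down.val = i'.down.val) : FinS.fibMap θ ψ φ h i ≍ FinS.fibMap θ' ψ' φ' h' i' :=
  tri_congr (C := FinS.{u}) (h := h) (h' := h') ha hb hc hφ hψ i i' hi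

theorem pi_hom_heq {I : Type u} {D : I → Type u} [∀ i, Category.{u} (D i)] {X Y X' Y' : ∀ i, D i}
    (hX : X = X') (hY : Y = Y') {f : X ⟶ Y} {g : X' ⟶ Y'} (h : ∀ i, f i ≍ g i) : f ≍ g := by
  subst hX hY
  exact heq_of_eq (funext fun i => eq_of_heq (h i))

/-- `X * Y`. -/
abbrev tens {E : Type w} [Category.{v} E] [SkewMonoidal E] (X Y : E) : E := tensor.obj (X, Y)

/-- An opmonoidal functor from `E` to `Coll_𝒮` with underlying functor `Φ` followed by `p_!`, with
cartesian `P²`. The functor is a composite by definition, and not by a propositional equality.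
Only what is needed of the invertibility of `Φ` is recorded: `E` has a terminal object `1`, and
`Φ 1` is the identity of `C` up to a bijection. -/
structure Presentation (E : Type (u + 1)) [Category.{u} E] [SkewMonoidal E] {C : Type u}
    (p : C → FinS.{u}) where
  Φ : E ⥤ Over C
  two : tensor (E := E) ⋙ (Φ ⋙ shriek p) ⟶
    (Φ ⋙ shriek p).prod (Φ ⋙ shriek p) ⋙ tensor (E := Over FinS.{u})
  zero : (Φ ⋙ shriek p).obj (unit (E := E)) ⟶ unit (E := Over FinS.{u})
  two_α (X Y Z : E) :
    two.app (tensor.obj (X, Y), Z) ≫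
        tensor.map (two.app (X, Y) ×ₘ 𝟙 ((Φ ⋙ shriek p).obj Z)) ≫
        α ((Φ ⋙ shriek p).obj X) ((Φ ⋙ shriek p).obj Y) ((Φ ⋙ shriek p).obj Z) =
      (Φ ⋙ shriek p).map (α X Y Z) ≫ two.app (X, tensor.obj (Y, Z)) ≫
        tensor.map (𝟙 ((Φ ⋙ shriek p).obj X) ×ₘ two.app (Y, Z))
  two_lam (X : E) :
    two.app (unit, X) ≫ tensor.map (zero ×ₘ 𝟙 ((Φ ⋙ shriek p).obj X)) ≫
      lam ((Φ ⋙ shriek p).obj X) = (Φ ⋙ shriek p).map (lam X)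
  two_ρ (X : E) :
    (Φ ⋙ shriek p).map (ρ X) ≫ two.app (X, unit) ≫
      tensor.map (𝟙 ((Φ ⋙ shriek p).obj X) ×ₘ zero) = ρ ((Φ ⋙ shriek p).obj X)
  equifibered : NatTrans.Equifibered two
  one : E
  isTerminal : Limits.IsTerminal one
  one_bijective : Function.Bijective (bd (Φ.obj one))

namespace Presentation

variable {E : Type (u + 1)} [Category.{u} E] [SkewMonoidal E] {C : Type u} {p : C → FinS.{u}}
  (S : Presentation E p)

/-- The elements of the set over `C` that presents an object of `E`. -/
abbrev el (X : E) : Type u := (S.Φ.obj X).left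

/-- The element of `C` over which an element lies. -/
def ob {X : E} (x : S.el X) : C := bd (S.Φ.obj X) x

/-- The action of morphisms of `E` on elements. -/
def mp {X Y : E} (f : X ⟶ Y) (x : S.el X) : S.el Y := fn (S.Φ.map f) x

theorem ob_mp {X Y : E} (f : X ⟶ Y) (x : S.el X) : S.ob (S.mp f x) = S.ob x :=
  bd_fn (S.Φ.map f) x

theorem mp_comp {X Y Z : E} (f : X ⟶ Y) (g : Y ⟶ Z) (x : S.el X) :
    S.mp (f ≫ g) x = S.mp g (S.mp f x) :=
  fn_congr (S.Φ.map_comp f g) x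

theorem mp_id {X : E} (x : S.el X) : S.mp (𝟙 X) x = x :=
  fn_congr (S.Φ.map_id X) x

/-- The triple `(x, φ, y)` which `P²` assigns to an element of `X * Y`. -/
noncomputable def tr {X Y : E} (s : S.el (tens X Y)) :
    TensorEl ((shriek p).obj (S.Φ.obj X)) ((shriek p).obj (S.Φ.obj Y)) :=
  fn (S.two.app (X, Y)) s

/-- The component `x` of the triple `(x, φ, y)` of an element of `X * Y`. -/
noncomputable def fst {X Y : E} (s : S.el (tens X Y)) : S.el X := (S.tr s).x

theorem tr_dom {X Y : E} (s : S.el (tens X Y)) : (S.tr s).dom = p (S.ob s) :=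
  bd_fn (S.two.app (X, Y)) s

theorem tr_cod {X Y : E} (s : S.el (tens X Y)) : (S.tr s).cod = p (S.ob (S.fst s)) :=
  (S.tr s).hx.symm

/-- The component `φ` of the triple `(x, φ, y)` of an element of `X * Y`, a function between
finite sets, transported to have the expected domain and codomain. -/
noncomputable def arr {X Y : E} (s : S.el (tens X Y)) : p (S.ob s) ⟶ p (S.ob (S.fst s)) :=
  homCast (S.tr_dom s) (S.tr_cod s) (S.tr s).φ

theorem arr_heq {X Y : E} (s : S.el (tens X Y)) : S.arr s ≍ (S.tr s).φ :=
  homCast_heq _ _ _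

/-- The component `y` of the triple `(x, φ, y)` of an element of `X * Y`, a family of elements of
`Y`. The index is a bare natural number with a bound, so that indices need no transport when the
first component is rewritten. -/
noncomputable def snd {X Y : E} (s : S.el (tens X Y)) (n : ℕ)
    (h : n < (p (S.ob (S.fst s))).len) : S.el Y :=
  (S.tr s).y ⟨⟨n, (congrArg FintypeCat.Skeleton.len (S.tr_cod s)).symm ▸ h⟩⟩

theorem snd_eq {X Y : E} (s : S.el (tens X Y)) (n : ℕ) (h : n < (p (S.ob (S.fst s))).len)
    (i : El (S.tr s).cod) (hi : i.down.val = n) : S.snd s n h = (S.tr s).y i := by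
  subst hi
  rfl

theorem card_snd {X Y : E} (s : S.el (tens X Y)) (n : ℕ) (h : n < (p (S.ob (S.fst s))).len) :
    p (S.ob (S.snd s n h)) = FinS.fib (S.arr s) ⟨⟨n, h⟩⟩ :=
  ((S.tr s).hy _).trans (fib_congr (C := FinS.{u}) (S.tr_dom s) (S.tr_cod s) (S.arr_heq s).symm
    _ _ rfl)

theorem tr_mp {X X' Y Y' : E} (f : X ⟶ X') (g : Y ⟶ Y') (s : S.el (tens X Y)) :
    S.tr (S.mp (tensor.map (f ×ₘ g)) s) =
      fn (collTensorMap ((shriek p).map (S.Φ.map f)) ((shriek p).map (S.Φ.map g))) (S.tr s) :=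
  fn_congr (S.two.naturality (f ×ₘ g)) s

theorem fst_mp {X X' Y Y' : E} (f : X ⟶ X') (g : Y ⟶ Y') (s : S.el (tens X Y)) :
    S.fst (S.mp (tensor.map (f ×ₘ g)) s) = S.mp f (S.fst s) := by
  rw [fst, tr_mp]
  rfl

theorem ob_fst_mp {X X' Y Y' : E} (f : X ⟶ X') (g : Y ⟶ Y') (s : S.el (tens X Y)) :
    S.ob (S.fst (S.mp (tensor.map (f ×ₘ g)) s)) = S.ob (S.fst s) := by
  rw [fst_mp, ob_mp]

theorem tr_y_congr {X Y : E} {s t : TensorEl (C := FinS.{u}) ((shriek p).obj (S.Φ.obj X))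
    ((shriek p).obj (S.Φ.obj Y))} (h : s = t) (i : El s.cod) (j : El t.cod)
    (hij : i.down.val = j.down.val) : s.y i = t.y j := by
  subst h
  obtain rfl : i = j := ULift.ext _ _ (Fin.ext hij)
  rfl

theorem snd_mp {X X' Y Y' : E} (f : X ⟶ X') (g : Y ⟶ Y') (s : S.el (tens X Y)) (n : ℕ)
    (h : n < (p (S.ob (S.fst (S.mp (tensor.map (f ×ₘ g)) s)))).len)
    (h' : n < (p (S.ob (S.fst s))).len) :
    S.snd (S.mp (tensor.map (f ×ₘ g)) s) n h = S.mp g (S.snd s n h') := by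
  refine (S.tr_y_congr (S.tr_mp f g s) _ ⟨⟨n, ?_⟩⟩ rfl).trans rfl
  exact (congrArg FintypeCat.Skeleton.len (S.tr_cod s)).symm ▸ h'

theorem snd_congr {X Y : E} {s s' : S.el (tens X Y)} (hs : s = s') {n n' : ℕ} (hn : n = n')
    (h : n < (p (S.ob (S.fst s))).len) (h' : n' < (p (S.ob (S.fst s'))).len) :
    S.snd s n h = S.snd s' n' h' := by
  subst hs hn
  rfl

theorem arr_mp {X X' Y Y' : E} (f : X ⟶ X') (g : Y ⟶ Y') (s : S.el (tens X Y)) :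
    S.arr (S.mp (tensor.map (f ×ₘ g)) s) ≍ S.arr s := by
  refine (S.arr_heq _).trans (HEq.trans ?_ (S.arr_heq s).symm)
  rw [tr_mp]
  rfl

theorem arr_congr {X Y : E} {s s' : S.el (tens X Y)} (hs : s = s') : S.arr s ≍ S.arr s' := by
  rw [hs]

/-! ### Shapes -/

/-- The elements of `1 * 1`, which will be the morphisms of the operadic category: a shape `m` has
domain `ob m`, codomain `ob (fst m)` and fibres `ob (snd m j)`. -/
abbrev Shape : Type u := S.el (tens S.one S.one)

/-- The shape of an element of `X * Y`: its image in `1 * 1`. -/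
def shape {X Y : E} (s : S.el (tens X Y)) : S.Shape :=
  S.mp (tensor.map (S.isTerminal.from X ×ₘ S.isTerminal.from Y)) s

theorem shape_mp {X X' Y Y' : E} (f : X ⟶ X') (g : Y ⟶ Y') (s : S.el (tens X Y)) :
    S.shape (S.mp (tensor.map (f ×ₘ g)) s) = S.shape s := by
  rw [shape, ← mp_comp, tensor_comp, S.isTerminal.comp_from, S.isTerminal.comp_from]
  rfl

theorem shape_self (m : S.Shape) : S.shape m = m := by
  rw [shape, S.isTerminal.from_self]
  exact (congrArg (fun f => S.mp f m) (tensor.map_id _)).trans (S.mp_id m)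

theorem ob_shape {X Y : E} (s : S.el (tens X Y)) : S.ob (S.shape s) = S.ob s := S.ob_mp _ _

theorem ob_fst_shape {X Y : E} (s : S.el (tens X Y)) :
    S.ob (S.fst (S.shape s)) = S.ob (S.fst s) := S.ob_fst_mp _ _ _

theorem ob_snd_shape {X Y : E} (s : S.el (tens X Y)) (n : ℕ)
    (h : n < (p (S.ob (S.fst (S.shape s)))).len) (h' : n < (p (S.ob (S.fst s))).len) :
    S.ob (S.snd (S.shape s) n h) = S.ob (S.snd s n h') := by
  exact (congrArg S.ob (S.snd_mp _ _ s n h h')).trans (S.ob_mp _ _)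

theorem arr_shape {X Y : E} (s : S.el (tens X Y)) : S.arr (S.shape s) ≍ S.arr s :=
  S.arr_mp _ _ _

/-- An element of `X * Y` is determined by its shape and its components in `X` and `Y`. This is
the uniqueness part of the pullback property of `P²` along the maps to `1`. -/
theorem tens_ext {X Y : E} {s s' : S.el (tens X Y)} (h : S.shape s = S.shape s')
    (h1 : S.fst s = S.fst s') (h2 : ∀ n hn hn', S.snd s n hn = S.snd s' n hn') : s = s' := by
  have hT : S.tr s = S.tr s' := by
    have ho : S.ob s = S.ob s' := by rw [← ob_shape, h, ob_shape]
    refine TensorEl.ext' ?_ ?_ ?_ h1 fun i j hij => ?_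
    · rw [tr_dom, tr_dom, ho]
    · rw [tr_cod, tr_cod, h1]
    · refine (S.arr_heq s).symm.trans (HEq.trans ?_ (S.arr_heq s'))
      refine (S.arr_shape s).symm.trans (HEq.trans ?_ (S.arr_shape s'))
      rw [h]
    · have hi := lt_of_lt_of_eq i.down.isLt (congrArg FintypeCat.Skeleton.len (S.tr_cod s))
      have hj := lt_of_lt_of_eq j.down.isLt (congrArg FintypeCat.Skeleton.len (S.tr_cod s'))
      refine (S.snd_eq s _ hi i rfl).symm.trans (Eq.trans ?_ (S.snd_eq s' _ hj j rfl))
      exact (h2 _ hi (hij ▸ hj)).trans (S.snd_congr rfl hij _ _)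
  exact (existsUnique_of_isPullback (S.equifibered (S.isTerminal.from X ×ₘ S.isTerminal.from Y))
    (S.shape s) (S.tr s) (S.tr_mp _ _ s)).unique ⟨rfl, rfl⟩ ⟨h.symm, hT.symm⟩

theorem one_ext {x y : S.el S.one} (h : S.ob x = S.ob y) : x = y := S.one_bijective.1 h

/-- There is an element of `X * Y` with given shape and components, as soon as the components lie
over the right elements of `C`. This is the existence part of the pullback property of `P²` along
the maps to `1`. -/
theorem exists_tens {X Y : E} (m : S.Shape) (x : S.el X) (hx : S.ob x = S.ob (S.fst m))
    (y : ∀ n, n < (p (S.ob (S.fst m))).len → S.el Y)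
    (hy : ∀ n h, S.ob (y n h) = S.ob (S.snd m n h)) :
    ∃ s : S.el (tens X Y), S.shape s = m ∧ S.fst s = x ∧ ∀ n h h', S.snd s n h = y n h' := by
  have hc := congrArg FintypeCat.Skeleton.len (S.tr_cod m)
  let t : TensorEl ((shriek p).obj (S.Φ.obj X)) ((shriek p).obj (S.Φ.obj Y)) :=
    ⟨(S.tr m).dom, (S.tr m).cod, (S.tr m).φ, x, (congrArg p hx).trans (S.tr_cod m).symm,
      fun i => y i.down.val (lt_of_lt_of_eq i.down.isLt hc),
      fun i => (congrArg p (hy _ _)).trans ((S.tr m).hy i)⟩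
  have ht : S.tr m = fn (collTensorMap ((shriek p).map (S.Φ.map (S.isTerminal.from X)))
      ((shriek p).map (S.Φ.map (S.isTerminal.from Y)))) t := by
    refine TensorEl.ext' rfl rfl HEq.rfl ?_ fun i j hij => ?_
    · exact S.one_ext (hx.symm.trans (S.ob_mp _ _).symm)
    · obtain rfl : i = j := ULift.ext _ _ (Fin.ext hij)
      exact S.one_ext ((hy i.down.val (lt_of_lt_of_eq i.down.isLt hc)).symm.trans
        (S.ob_mp _ _).symm)
  obtain ⟨s, ⟨h1, h2⟩, -⟩ := existsUnique_of_isPullback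
    (S.equifibered (S.isTerminal.from X ×ₘ S.isTerminal.from Y)) m t ht
  have h2 : S.tr s = t := h2
  refine ⟨s, h1, congrArg TensorEl.x h2, fun n h h' => ?_⟩
  exact S.tr_y_congr h2 _ ⟨⟨n, lt_of_lt_of_eq h' hc.symm⟩⟩ rfl

/-! ### Composition of shapes -/

/-- The components of `α s` for `s ∈ (X * Y) * Z`, as prescribed by the compatibility of `P` with
`α`. -/
theorem α_spec {X Y Z : E} (s : S.el (tens (tens X Y) Z)) :
    S.fst (S.mp (α X Y Z) s) = S.fst (S.fst s) ∧
    S.arr (S.mp (α X Y Z) s) ≍ S.arr s ≫ S.arr (S.fst s) ∧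
    ∀ j h h', S.fst (S.snd (S.mp (α X Y Z) s) j h) = S.snd (S.fst s) j h' ∧
      S.arr (S.snd (S.mp (α X Y Z) s) j h) ≍
        FinS.fibMap (S.arr s ≫ S.arr (S.fst s)) (S.arr (S.fst s)) (S.arr s) rfl ⟨⟨j, h'⟩⟩ ∧
      ∀ k hk hk' l hl, l = (FinS.incl (S.arr (S.fst s)) ⟨⟨j, h'⟩⟩ ⟨⟨k, hk'⟩⟩).down.val →
        S.snd (S.snd (S.mp (α X Y Z) s) j h) k hk = S.snd s l hl := by
  let u : TensorEl (collTensorObj ((shriek p).obj (S.Φ.obj X)) ((shriek p).obj (S.Φ.obj Y)))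
      ((shriek p).obj (S.Φ.obj Z)) :=
    fn (collTensorMap (S.two.app (X, Y)) (𝟙 _)) (S.tr s)
  have e : collAssocFun u = fn (collTensorMap (𝟙 _) (S.two.app (Y, Z))) (S.tr (S.mp (α X Y Z) s)) :=
    fn_congr (S.two_α X Y Z) s
  obtain ⟨h1, h2, h3, h4⟩ := collAssoc_spec (C := FinS.{u}) u (S.arr s) (S.arr (S.fst s))
    (S.tr (S.fst s)) rfl (S.tr_dom s) (S.tr_cod s) (S.arr_heq s).symm (S.tr_cod (S.fst s))
    (S.arr_heq (S.fst s)).symm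
  rw [e] at h1 h2 h3 h4
  refine ⟨h3, (S.arr_heq _).trans h2, fun j h h' => ?_⟩
  obtain ⟨h5, h6, h7, h8, h9⟩ := h4
    ⟨⟨j, lt_of_lt_of_eq h (congrArg FintypeCat.Skeleton.len (S.tr_cod _)).symm⟩⟩ ⟨⟨j, h'⟩⟩ rfl
    (S.tr (S.snd (S.mp (α X Y Z) s) j h)) rfl
  refine ⟨?_, (S.arr_heq _).trans h7, fun k hk hk' l hl hlk => ?_⟩
  · exact h8 ⟨⟨j, lt_of_lt_of_eq h' (congrArg FintypeCat.Skeleton.len (S.tr_cod _)).symm⟩⟩ rfl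
  · exact h9 ⟨⟨k, lt_of_lt_of_eq hk (congrArg FintypeCat.Skeleton.len (S.tr_cod _)).symm⟩⟩
      ⟨⟨k, hk'⟩⟩ ⟨⟨l, lt_of_lt_of_eq hl (congrArg FintypeCat.Skeleton.len (S.tr_cod _)).symm⟩⟩
      rfl hlk

/-- A shape `φ` and an element `t` of `Y * 1` that lies over the codomain of `φ` combine to an
element of `(Y * 1) * 1`. -/
theorem exists_pair {Y : E} (t : S.el (tens Y S.one)) (φ : S.Shape)
    (h : S.ob (S.fst φ) = S.ob t) :
    ∃ s : S.el (tens (tens Y S.one) S.one), S.shape s = φ ∧ S.fst s = t := by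
  obtain ⟨s, h1, h2, -⟩ := S.exists_tens (X := tens Y S.one) (Y := S.one) φ t h.symm
    (fun n hn => (S.one_bijective.2 (S.ob (S.snd φ n hn))).choose)
    (fun n hn => (S.one_bijective.2 (S.ob (S.snd φ n hn))).choose_spec)
  exact ⟨s, h1, h2⟩

/-- The element of `(1 * 1) * 1` given by composable shapes `φ` and `ψ`, in diagrammatic order. -/
noncomputable def pair (φ ψ : S.Shape) (h : S.ob (S.fst φ) = S.ob ψ) :
    S.el (tens (tens S.one S.one) S.one) :=
  (S.exists_pair ψ φ h).choose

theorem shape_pair (φ ψ : S.Shape) (h : S.ob (S.fst φ) = S.ob ψ) : S.shape (S.pair φ ψ h) = φ :=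
  (S.exists_pair ψ φ h).choose_spec.1

theorem fst_pair (φ ψ : S.Shape) (h : S.ob (S.fst φ) = S.ob ψ) : S.fst (S.pair φ ψ h) = ψ :=
  (S.exists_pair ψ φ h).choose_spec.2

theorem ob_pair (φ ψ : S.Shape) (h : S.ob (S.fst φ) = S.ob ψ) : S.ob (S.pair φ ψ h) = S.ob φ := by
  rw [← ob_shape, shape_pair]

/-- The element of `1 * (1 * 1)` that corresponds to a composable pair of shapes under `α`. -/
noncomputable def assoc (φ ψ : S.Shape) (h : S.ob (S.fst φ) = S.ob ψ) :
    S.el (tens S.one (tens S.one S.one)) :=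
  S.mp (α _ _ _) (S.pair φ ψ h)

theorem fst_assoc (φ ψ : S.Shape) (h : S.ob (S.fst φ) = S.ob ψ) :
    S.fst (S.assoc φ ψ h) = S.fst ψ :=
  (S.α_spec _).1.trans (congrArg S.fst (S.fst_pair φ ψ h))

/-- The composite of two shapes. -/
noncomputable def cmp (φ ψ : S.Shape) (h : S.ob (S.fst φ) = S.ob ψ) : S.Shape :=
  S.shape (S.assoc φ ψ h)

/-- The shape `φ^ψ` over `j`, a morphism from the `j`-th fibre of the composite to that of `ψ`. -/
noncomputable def trg (φ ψ : S.Shape) (h : S.ob (S.fst φ) = S.ob ψ) (j : ℕ)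
    (hj : j < (p (S.ob (S.fst ψ))).len) : S.Shape :=
  S.snd (S.assoc φ ψ h) j (lt_of_lt_of_eq hj (by rw [fst_assoc]))

theorem mp_eq_pair {X Y Z : E} (s : S.el (tens (tens X Y) Z)) (h) :
    S.mp (tensor.map (tensor.map (S.isTerminal.from X ×ₘ S.isTerminal.from Y) ×ₘ
      S.isTerminal.from Z)) s = S.pair (S.shape s) (S.shape (S.fst s)) h := by
  refine S.tens_ext ?_ ?_ fun n hn hn' => S.one_ext ?_
  · rw [shape_mp, shape_pair]
  · rw [fst_mp, fst_pair]
    rfl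
  · rw [fst_mp] at hn
    have e : ∀ s : S.el (tens (tens S.one S.one) S.one), ∀ hn : n < (p (S.ob (S.fst s))).len,
        S.ob (S.snd s n hn) = S.ob (S.snd (S.shape s) n (by rwa [ob_fst_shape])) :=
      fun s hn => (S.ob_snd_shape s n _ hn).symm
    refine (e _ _).trans (Eq.trans ?_ (e _ _).symm)
    refine congrArg S.ob (S.snd_congr ?_ rfl _ _)
    rw [shape_mp, shape_pair]

/-- By naturality of `α`, all elements of `(X * Y) * Z` with the same pair of shapes have the same
image under `α` in `1 * (1 * 1)`. -/
theorem mp_α_eq {X Y Z : E} (s : S.el (tens (tens X Y) Z)) (φ ψ : S.Shape)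
    (h : S.ob (S.fst φ) = S.ob ψ) (hφ : S.shape s = φ) (hψ : S.shape (S.fst s) = ψ) :
    S.mp (tensor.map (S.isTerminal.from X ×ₘ
      tensor.map (S.isTerminal.from Y ×ₘ S.isTerminal.from Z))) (S.mp (α X Y Z) s) =
      S.assoc φ ψ h := by
  subst hφ hψ
  rw [← mp_comp, ← α_naturality, mp_comp, S.mp_eq_pair s h]
  rfl

theorem shape_α {X Y Z : E} (s : S.el (tens (tens X Y) Z)) (φ ψ : S.Shape)
    (h : S.ob (S.fst φ) = S.ob ψ) (hφ : S.shape s = φ) (hψ : S.shape (S.fst s) = ψ) :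
    S.shape (S.mp (α X Y Z) s) = S.cmp φ ψ h := by
  rw [cmp, ← S.mp_α_eq s φ ψ h hφ hψ, shape_mp]

theorem shape_snd_α {X Y Z : E} (s : S.el (tens (tens X Y) Z)) (φ ψ : S.Shape)
    (h : S.ob (S.fst φ) = S.ob ψ) (hφ : S.shape s = φ) (hψ : S.shape (S.fst s) = ψ) (j : ℕ)
    (hj hj') : S.shape (S.snd (S.mp (α X Y Z) s) j hj) = S.trg φ ψ h j hj' := by
  refine Eq.trans ?_ (S.snd_congr (S.mp_α_eq s φ ψ h hφ hψ) rfl ?_ _)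
  · exact (S.snd_mp _ _ _ j _ hj).symm
  · rw [ob_fst_mp]
    exact hj

/-! ### Domains, codomains, fibres and cardinalities of composites -/

theorem ob_cmp (φ ψ : S.Shape) (h : S.ob (S.fst φ) = S.ob ψ) : S.ob (S.cmp φ ψ h) = S.ob φ := by
  rw [cmp, ob_shape, assoc, ob_mp, ob_pair]

theorem ob_fst_cmp (φ ψ : S.Shape) (h : S.ob (S.fst φ) = S.ob ψ) :
    S.ob (S.fst (S.cmp φ ψ h)) = S.ob (S.fst ψ) := by
  rw [cmp, ob_fst_shape, fst_assoc]

theorem ob_trg (φ ψ : S.Shape) (h : S.ob (S.fst φ) = S.ob ψ) (j : ℕ) (hj hj') :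
    S.ob (S.trg φ ψ h j hj) = S.ob (S.snd (S.cmp φ ψ h) j hj') :=
  (S.ob_snd_shape _ j _ _).symm

theorem arr_cmp (φ ψ : S.Shape) (h : S.ob (S.fst φ) = S.ob ψ) :
    S.arr (S.cmp φ ψ h) ≍ S.arr (S.pair φ ψ h) ≫ S.arr (S.fst (S.pair φ ψ h)) :=
  (S.arr_shape _).trans (S.α_spec (S.pair φ ψ h)).2.1

theorem arr_pair (φ ψ : S.Shape) (h : S.ob (S.fst φ) = S.ob ψ) :
    S.arr (S.pair φ ψ h) ≍ S.arr φ :=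
  (S.arr_shape _).symm.trans (S.arr_congr (S.shape_pair φ ψ h))

theorem arr_fst_pair (φ ψ : S.Shape) (h : S.ob (S.fst φ) = S.ob ψ) :
    S.arr (S.fst (S.pair φ ψ h)) ≍ S.arr ψ :=
  S.arr_congr (S.fst_pair φ ψ h)

theorem fst_trg (φ ψ : S.Shape) (h : S.ob (S.fst φ) = S.ob ψ) (j : ℕ) (hj) :
    S.fst (S.trg φ ψ h j hj) = S.snd ψ j hj :=
  (((S.α_spec (S.pair φ ψ h)).2.2 j _ (by rwa [fst_pair])).1).trans
    (S.snd_congr (S.fst_pair φ ψ h) rfl _ _)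

theorem arr_trg (φ ψ : S.Shape) (h : S.ob (S.fst φ) = S.ob ψ) (j : ℕ) (hj) (hj') :
    S.arr (S.trg φ ψ h j hj) ≍ FinS.fibMap (S.arr (S.pair φ ψ h) ≫ S.arr (S.fst (S.pair φ ψ h)))
      (S.arr (S.fst (S.pair φ ψ h))) (S.arr (S.pair φ ψ h)) rfl ⟨⟨j, hj'⟩⟩ :=
  ((S.α_spec (S.pair φ ψ h)).2.2 j _ hj').2.1

/-- The fibre of `φ^ψ` over an element `k` of the `j`-th fibre of `ψ` is the fibre of `φ` over the
element `l` of the domain of `ψ` to which `k` corresponds. -/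
theorem ob_snd_trg (φ ψ : S.Shape) (h : S.ob (S.fst φ) = S.ob ψ) (j : ℕ) (hj) (k hk hk' l hl)
    (hlk : l = (FinS.incl (S.arr ψ) ⟨⟨j, hj⟩⟩ ⟨⟨k, hk'⟩⟩).down.val) :
    S.ob (S.snd (S.trg φ ψ h j hj) k hk) = S.ob (S.snd φ l hl) := by
  have e := S.fst_pair φ ψ h
  have hj' : j < (p (S.ob (S.fst (S.fst (S.pair φ ψ h))))).len := by rwa [e]
  have hk₁ : k < (FinS.fib (S.arr (S.fst (S.pair φ ψ h))) ⟨⟨j, hj'⟩⟩).len := by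
    refine lt_of_lt_of_eq hk' (congrArg FintypeCat.Skeleton.len ?_)
    exact fib_congr (C := FinS.{u}) (by rw [e]) (by rw [e]) (S.arr_congr e.symm) _ _ rfl
  have hl' : l < (p (S.ob (S.fst (S.pair φ ψ h)))).len := by rwa [e, ← h]
  refine (congrArg S.ob (((S.α_spec (S.pair φ ψ h)).2.2 j _ hj').2.2 k hk hk₁ l hl' ?_)).trans ?_
  · rw [hlk]
    exact FinS.incl_congr (by rw [e]) (by rw [e]) (S.arr_congr e.symm) _ _ rfl _ _ rfl
  · refine (S.ob_snd_shape _ l ?_ hl').symm.trans (congrArg S.ob (S.snd_congr ?_ rfl _ _))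
    · rw [ob_fst_shape]
      exact hl'
    · exact S.shape_pair φ ψ h

/-- The pentagon axiom for an element of `((1 * 1) * 1) * 1`, that is, for a composable triple of
shapes. Comparing the components of its two images in `1 * (1 * (1 * 1))` gives associativity of
composition, functoriality of the fibres, and the double slice condition on morphisms. -/
theorem pentagon_el (χ φ ψ : S.Shape) (h1 : S.ob (S.fst χ) = S.ob φ)
    (h2 : S.ob (S.fst φ) = S.ob ψ) (h3 h4) :
    S.cmp χ (S.cmp φ ψ h2) h3 = S.cmp (S.cmp χ φ h1) ψ h4 ∧
    ∀ j hj hj' hj'' h5, S.cmp (S.trg χ (S.cmp φ ψ h2) h3 j hj) (S.trg φ ψ h2 j hj') h5 =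
        S.trg (S.cmp χ φ h1) ψ h4 j hj'' ∧
      ∀ k hk hk' l hl, l = (FinS.incl (S.arr ψ) ⟨⟨j, hj'⟩⟩ ⟨⟨k, hk'⟩⟩).down.val →
        S.trg (S.trg χ (S.cmp φ ψ h2) h3 j hj) (S.trg φ ψ h2 j hj') h5 k hk =
          S.trg χ φ h1 l hl := by
  obtain ⟨s, hs, hf⟩ := S.exists_pair (S.pair φ ψ h2) χ (by rw [ob_pair, h1])
  have e : S.mp (tensor.map (𝟙 _ ×ₘ α _ _ _))
      (S.mp (α _ _ _) (S.mp (tensor.map (α _ _ _ ×ₘ 𝟙 _)) s)) =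
      S.mp (α _ _ _) (S.mp (α _ _ _) s) := by
    rw [← mp_comp, ← mp_comp, ← mp_comp, ← pentagon]
  have f1 : S.fst (S.mp (tensor.map (α S.one S.one S.one ×ₘ 𝟙 S.one)) s) = S.assoc φ ψ h2 := by
    rw [fst_mp, hf]
    rfl
  have g1 : S.shape (S.mp (tensor.map (α S.one S.one S.one ×ₘ 𝟙 S.one)) s) = χ := by
    rw [shape_mp, hs]
  have f4 : S.fst (S.mp (α (tens S.one S.one) S.one S.one) s) = ψ := by
    rw [(S.α_spec s).1, hf, fst_pair]
  have g4 : S.shape (S.mp (α (tens S.one S.one) S.one S.one) s) = S.cmp χ φ h1 :=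
    S.shape_α s χ φ h1 hs (by rw [hf, shape_pair])
  generalize S.mp (tensor.map (α S.one S.one S.one ×ₘ 𝟙 S.one)) s = s1 at e f1 g1
  have g1' : S.shape (S.fst s1) = S.cmp φ ψ h2 := by
    rw [f1]
    rfl
  have f2 : S.fst (S.mp (α _ _ _) s1) = S.fst ψ := by
    rw [(S.α_spec s1).1, f1, fst_assoc]
  have g4' : S.shape (S.fst (S.mp (α (tens S.one S.one) S.one S.one) s)) = ψ := by
    rw [f4, shape_self]
  have f5 : S.fst (S.mp (α _ _ _) (S.mp (α (tens S.one S.one) S.one S.one) s)) = S.fst ψ := by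
    rw [(S.α_spec _).1, f4]
  refine ⟨?_, fun j hj hj' hj'' h5 => ?_⟩
  · rw [← S.shape_α s1 χ (S.cmp φ ψ h2) h3 g1 g1', ← S.shape_α _ (S.cmp χ φ h1) ψ h4 g4 g4', ← e,
      shape_mp]
  have hj2 : j < (p (S.ob (S.fst (S.mp (α S.one (tens S.one S.one) S.one) s1)))).len := by
    rwa [f2]
  have hj5 : j < (p (S.ob (S.fst (S.mp (α _ _ _)
      (S.mp (α (tens S.one S.one) S.one S.one) s))))).len := by
    rwa [f5]
  have q1 : S.shape (S.snd (S.mp (α _ _ _) s1) j hj2) = S.trg χ (S.cmp φ ψ h2) h3 j hj :=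
    S.shape_snd_α s1 χ (S.cmp φ ψ h2) h3 g1 g1' j hj2 hj
  have q2 : S.fst (S.snd (S.mp (α _ _ _) s1) j hj2) = S.trg φ ψ h2 j hj' :=
    ((S.α_spec s1).2.2 j hj2 (by rw [f1, fst_assoc]; exact hj')).1.trans
      (S.snd_congr f1 rfl _ _)
  have q2' : S.shape (S.fst (S.snd (S.mp (α _ _ _) s1) j hj2)) = S.trg φ ψ h2 j hj' := by
    rw [q2, shape_self]
  have q3 : S.mp (α _ _ _) (S.snd (S.mp (α _ _ _) s1) j hj2) =
      S.snd (S.mp (α _ _ _) (S.mp (α (tens S.one S.one) S.one S.one) s)) j hj5 := by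
    refine (S.snd_mp (𝟙 S.one) (α S.one S.one S.one) (S.mp (α _ _ _) s1) j ?_ hj2).symm.trans
      (S.snd_congr e rfl _ _)
    rw [ob_fst_mp]
    exact hj2
  refine ⟨?_, fun k hk hk' l hl hlk => ?_⟩
  · rw [← S.shape_α _ _ _ h5 q1 q2', q3]
    exact S.shape_snd_α _ _ ψ h4 g4 g4' j hj5 hj''
  · have hk2 : k < (p (S.ob (S.fst (S.mp (α _ _ _) (S.snd (S.mp (α _ _ _) s1) j hj2))))).len := by
      rw [(S.α_spec _).1, q2]
      exact hk
    have hl4 : l < (p (S.ob (S.fst (S.mp (α (tens S.one S.one) S.one S.one) s)))).len := by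
      rw [f4, ← h2]
      exact hl
    rw [← S.shape_snd_α _ _ _ h5 q1 q2' k hk2 hk]
    refine (congrArg S.shape ((S.snd_congr q3 rfl _ (by rw [← q3]; exact hk2)).trans
      (((S.α_spec (S.mp (α (tens S.one S.one) S.one S.one) s)).2.2 j hj5
        (by rw [f4]; exact hj')).2.2 k _ ?_ l hl4 ?_))).trans ?_
    · refine lt_of_lt_of_eq hk' (congrArg FintypeCat.Skeleton.len ?_)
      exact fib_congr (C := FinS.{u}) (by rw [f4]) (by rw [f4]) (S.arr_congr f4.symm) _ _ rfl
    · rw [hlk]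
      exact FinS.incl_congr (by rw [f4]) (by rw [f4]) (S.arr_congr f4.symm) _ _ rfl _ _ rfl
    · exact S.shape_snd_α s χ φ h1 hs (by rw [hf, shape_pair]) l hl4 _

/-! ### Identities -/

/-- The element of `1` over `c`. -/
noncomputable def pt (c : C) : S.el S.one := (S.one_bijective.2 c).choose

theorem ob_pt (c : C) : S.ob (S.pt c) = c := (S.one_bijective.2 c).choose_spec

/-- The compatibility of `P` with `ρ`, for an element. -/
theorem rho_el {X : E} (x : S.el X) :
    fn (collTensorMap (𝟙 ((shriek p).obj (S.Φ.obj X))) S.zero) (S.tr (S.mp (ρ X) x)) =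
      collRhoFun (X := (shriek p).obj (S.Φ.obj X)) x :=
  fn_congr (S.two_ρ X) x

theorem fst_ρ {X : E} (x : S.el X) : S.fst (S.mp (ρ X) x) = x :=
  congrArg TensorEl.x (S.rho_el x)

theorem arr_ρ {X : E} (x : S.el X) : S.arr (S.mp (ρ X) x) ≍ 𝟙 (p (S.ob x)) := by
  have h : ∀ {s t : TensorEl (C := FinS.{u}) ((shriek p).obj (S.Φ.obj X)) (collUnit FinS.{u})},
    s = t → s.φ ≍ t.φ := fun h => by rw [h]
  exact (S.arr_heq _).trans (h (S.rho_el x))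

/-- The image under `ρ` of the element of `1` over `c`. -/
noncomputable def rhoPt (c : C) : S.el (tens S.one unit) := S.mp (ρ S.one) (S.pt c)

theorem fst_rhoPt (c : C) : S.fst (S.rhoPt c) = S.pt c := S.fst_ρ _

/-- The identity shape of `c`. -/
noncomputable def idt (c : C) : S.Shape := S.shape (S.rhoPt c)

/-- The element of the unit `U` that lies over the `j`-th fibre of the identity of `c`. -/
noncomputable def idFib (c : C) (j : ℕ) (hj : j < (p c).len) : S.el (unit (E := E)) :=
  S.snd (S.rhoPt c) j (by rwa [fst_rhoPt, ob_pt])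

theorem mp_ρ_eq {X : E} (x : S.el X) (c : C) (hc : S.ob x = c) :
    S.mp (tensor.map (S.isTerminal.from X ×ₘ 𝟙 unit)) (S.mp (ρ X) x) = S.rhoPt c := by
  subst hc
  rw [← mp_comp, ← ρ_naturality, mp_comp]
  exact congrArg (S.mp (ρ S.one)) (S.one_ext (by rw [ob_mp, ob_pt]))

theorem shape_ρ {X : E} (x : S.el X) (c : C) (hc : S.ob x = c) :
    S.shape (S.mp (ρ X) x) = S.idt c := by
  rw [idt, ← S.mp_ρ_eq x c hc, shape_mp]

theorem snd_ρ {X : E} (x : S.el X) (c : C) (hc : S.ob x = c) (j : ℕ) (hj hj') :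
    S.snd (S.mp (ρ X) x) j hj = S.idFib c j hj' := by
  refine Eq.trans ?_ (S.snd_congr (S.mp_ρ_eq x c hc) rfl (by rwa [ob_fst_mp]) _)
  rw [S.snd_mp _ _ _ j _ hj, mp_id]

theorem ob_idt (c : C) : S.ob (S.idt c) = c := by
  rw [idt, ob_shape, rhoPt, ob_mp, ob_pt]

theorem ob_fst_idt (c : C) : S.ob (S.fst (S.idt c)) = c := by
  rw [idt, ob_fst_shape, fst_rhoPt, ob_pt]

theorem ob_snd_idt (c : C) (j : ℕ) (hj hj') :
    S.ob (S.snd (S.idt c) j hj) = S.ob (S.idFib c j hj') :=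
  S.ob_snd_shape _ j _ _

theorem arr_idt (c : C) : S.arr (S.idt c) ≍ 𝟙 (p c) := by
  refine (S.arr_shape _).trans ((S.arr_ρ _).trans ?_)
  rw [ob_pt]

/-- Left unitality of composition, from the `(α, ρ)`-axiom applied to `m`. -/
theorem id_cmp (m : S.Shape) (c : C) (hc : S.ob m = c) (h) : S.cmp (S.idt c) m h = m := by
  have e : S.mp (α _ _ _) (S.mp (ρ _) m) = S.mp (tensor.map (𝟙 _ ×ₘ ρ _)) m := by
    rw [← mp_comp, α_ρ]
  rw [← S.shape_α (S.mp (ρ (tens S.one S.one)) m) (S.idt c) m h (S.shape_ρ m c hc)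
    (by rw [fst_ρ, shape_self]), e, shape_mp, shape_self]

/-- The shape `1^m` is an identity, from the `(α, ρ)`-axiom applied to `m`. -/
theorem id_trg (m : S.Shape) (c : C) (hc : S.ob m = c) (h) (j : ℕ) (hj hj') :
    S.trg (S.idt c) m h j hj = S.idt (S.ob (S.snd m j hj')) := by
  have e : S.mp (α _ _ _) (S.mp (ρ _) m) = S.mp (tensor.map (𝟙 _ ×ₘ ρ _)) m := by
    rw [← mp_comp, α_ρ]
  have hj1 : j < (p (S.ob (S.fst (S.mp (tensor.map (𝟙 _ ×ₘ ρ S.one)) m)))).len := by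
    rwa [ob_fst_mp]
  have hj2 : j < (p (S.ob (S.fst (S.mp (α _ _ _) (S.mp (ρ (tens S.one S.one)) m))))).len := by
    rwa [e]
  rw [← S.shape_snd_α (S.mp (ρ (tens S.one S.one)) m) (S.idt c) m h (S.shape_ρ m c hc)
    (by rw [fst_ρ, shape_self]) j hj2 hj, S.snd_congr e rfl hj2 hj1, S.snd_mp _ _ _ j _ hj]
  exact S.shape_ρ _ _ rfl

/-- Right unitality of composition, from the `(λ, α, ρ)`-axiom applied to `m`. -/
theorem cmp_id (m : S.Shape) (c : C) (hc : S.ob (S.fst m) = c) (h) :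
    S.cmp m (S.idt c) h = m := by
  have e : S.mp (tensor.map (𝟙 S.one ×ₘ lam S.one)) (S.mp (α _ _ _)
      (S.mp (tensor.map (ρ S.one ×ₘ 𝟙 S.one)) m)) = m := by
    rw [← mp_comp, ← mp_comp, lam_α_ρ, mp_id]
  have h1 := S.shape_α (S.mp (tensor.map (ρ S.one ×ₘ 𝟙 S.one)) m) m (S.idt c) h
    (by rw [shape_mp, shape_self]) (by rw [fst_mp]; exact S.shape_ρ _ _ hc)
  rw [← h1, ← S.shape_mp (𝟙 S.one) (lam S.one), e, shape_self]

/-! ### Elements of the unit -/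

theorem len_ob_unit (a : S.el (unit (E := E))) : (p (S.ob a)).len = 1 := by
  have h1 : IsTrivial (C := FinS.{u}) (bd (collUnit FinS.{u}) (fn S.zero a)) :=
    Subtype.property (p := fun n : FinS.{u} => IsTrivial n) (fn S.zero a)
  exact (congrArg FintypeCat.Skeleton.len (bd_fn S.zero a)).symm.trans h1.1

/-- Over an element of `U` there is only the fibre with index `0`, and `λ` projects to it. -/
theorem mp_lam {X : E} (s : S.el (tens unit X)) (h) : S.mp (lam X) s = S.snd s 0 h := by
  refine (fn_congr (S.two_lam X) s).symm.trans ?_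
  rfl

theorem zero_lt (a : S.el (unit (E := E))) : 0 < (p (S.ob a)).len := by
  rw [len_ob_unit]
  exact one_pos

theorem ob_snd_unit {X : E} (s : S.el (tens unit X)) (h) : S.ob (S.snd s 0 h) = S.ob s := by
  rw [← mp_lam, ob_mp]

/-- If the codomain of `ψ` lies under an element of `U`, then `φ^ψ` is `φ`, from the `(α,
λ)`-axiom. -/
theorem trg_unit (φ ψ : S.Shape) (h : S.ob (S.fst φ) = S.ob ψ) (a : S.el (unit (E := E)))
    (ha : S.ob (S.fst ψ) = S.ob a) (hj) : S.trg φ ψ h 0 hj = φ := by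
  obtain ⟨t, ht, htf, -⟩ := S.exists_tens (X := unit) (Y := S.one) ψ a ha.symm
    (fun n hn => S.pt _) (fun n hn => S.ob_pt _)
  obtain ⟨s, hs, hf⟩ := S.exists_pair t φ (by rw [h, ← ht, ob_shape])
  have e : S.mp (lam _) (S.mp (α _ _ _) s) = S.mp (tensor.map (lam _ ×ₘ 𝟙 _)) s := by
    rw [← mp_comp, α_lam]
  have h1 : 0 < (p (S.ob (S.fst (S.mp (α _ _ _) s)))).len := S.zero_lt _
  rw [S.mp_lam _ h1] at e
  rw [← S.shape_snd_α s φ ψ h hs (by rw [hf, ht]) 0 h1 hj, e, shape_mp, hs]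

theorem ob_snd_of_unit (ψ : S.Shape) (a : S.el (unit (E := E)))
    (ha : S.ob (S.fst ψ) = S.ob a) (hj) : S.ob (S.snd ψ 0 hj) = S.ob ψ := by
  obtain ⟨t, ht, htf, -⟩ := S.exists_tens (X := unit) (Y := S.one) ψ a ha.symm
    (fun n hn => S.pt _) (fun n hn => S.ob_pt _)
  subst ht
  rw [ob_shape, ← S.ob_snd_unit t (S.zero_lt _)]
  exact S.ob_snd_shape t 0 _ _

/-- An element of `U` is recovered from the element of `C` over which it lies, by the `(λ,
ρ)`-axiom. -/
theorem idFib_ob (a : S.el (unit (E := E))) (h) : S.idFib (S.ob a) 0 h = a := by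
  have h1 : 0 < (p (S.ob (S.fst (S.mp (ρ unit) a)))).len := S.zero_lt _
  rw [← S.snd_ρ a _ rfl 0 h1 h, ← S.mp_lam, ← mp_comp, lam_ρ, mp_id]

theorem unit_ext (a b : S.el (unit (E := E))) (h : S.ob a = S.ob b) : a = b := by
  rw [← S.idFib_ob a (S.zero_lt a), ← S.idFib_ob b (S.zero_lt b)]
  congr 1

/-! ### The operadic category of shapes -/

/-- The type of objects of the operadic category of shapes: a synonym of `C` which carries the
category structure determined by the presentation. -/
def Obj (_ : Presentation E p) : Type u := C

noncomputable instance : SmallCategory S.Obj where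
  Hom c d := {m : S.Shape // S.ob m = c ∧ S.ob (S.fst m) = d}
  id c := ⟨S.idt c, S.ob_idt c, S.ob_fst_idt c⟩
  comp φ ψ := ⟨S.cmp φ.1 ψ.1 (φ.2.2.trans ψ.2.1.symm), (S.ob_cmp _ _ _).trans φ.2.1,
    (S.ob_fst_cmp _ _ _).trans ψ.2.2⟩
  id_comp φ := Subtype.ext (S.id_cmp φ.1 _ φ.2.1 _)
  comp_id φ := Subtype.ext (S.cmp_id φ.1 _ φ.2.2 _)
  assoc χ φ ψ := Subtype.ext (S.pentagon_el χ.1 φ.1 ψ.1 (χ.2.2.trans φ.2.1.symm)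
    (φ.2.2.trans ψ.2.1.symm) _ _).1.symm

theorem hom_heq {c d c' d' : S.Obj} {f : c ⟶ d} {g : c' ⟶ d'} (hc : c = c') (hd : d = d')
    (h : f.1 = g.1) : f ≍ g := by
  subst hc hd
  exact heq_of_eq (Subtype.ext h)

theorem pair_ob_eq {c d e : S.Obj} (φ : c ⟶ d) (ψ : d ⟶ e) :
    S.ob (S.fst φ.1) = S.ob ψ.1 := φ.2.2.trans ψ.2.1.symm

/-- The function between finite sets underlying a shape. -/
noncomputable def cardMap {c d : S.Obj} (φ : c ⟶ d) : p c ⟶ p d :=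
  homCast (congrArg p φ.2.1) (congrArg p φ.2.2) (S.arr φ.1)

theorem cardMap_heq {c d : S.Obj} (φ : c ⟶ d) : S.cardMap φ ≍ S.arr φ.1 :=
  homCast_heq _ _ _

/-- The cardinality functor, which is `p` on objects. -/
noncomputable def card : S.Obj ⥤ FinS.{u} where
  obj c := p c
  map φ := S.cardMap φ
  map_id c := eq_of_heq ((S.cardMap_heq _).trans (S.arr_idt c))
  map_comp {c d e} φ ψ := by
    refine eq_of_heq ((S.cardMap_heq _).trans ((S.arr_cmp φ.1 ψ.1 (S.pair_ob_eq φ ψ)).trans ?_))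
    have e1 := S.fst_pair φ.1 ψ.1 (S.pair_ob_eq φ ψ)
    refine comp_heq ?_ ?_ ?_ ?_ ?_
    · rw [ob_pair, φ.2.1]
    · rw [e1, ψ.2.1]
    · rw [e1, ψ.2.2]
    · exact (S.arr_pair _ _ _).trans (S.cardMap_heq φ).symm
    · exact (S.arr_fst_pair _ _ _).trans (S.cardMap_heq ψ).symm

theorem idx_lt {c d : S.Obj} (ψ : c ⟶ d) (j : Idx (p d)) :
    j.down.val < (p (S.ob (S.fst ψ.1))).len :=
  lt_of_lt_of_eq j.down.isLt (by rw [ψ.2.2])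

/-- The `j`-th fibre of a morphism. -/
noncomputable def fibOb {c d : S.Obj} (ψ : c ⟶ d) (j : Idx (p d)) : S.Obj :=
  S.ob (S.snd ψ.1 j.down.val (S.idx_lt ψ j))

theorem snd_ob_congr {m m' : S.Shape} (hm : m = m') {j j' : ℕ} (hj : j = j')
    (h : j < (p (S.ob (S.fst m))).len) (h') : S.ob (S.snd m j h) = S.ob (S.snd m' j' h') :=
  congrArg S.ob (S.snd_congr hm hj h h')

theorem trg_congr {φ φ' ψ ψ' : S.Shape} (hφ : φ = φ') (hψ : ψ = ψ') {j j' : ℕ} (hj : j = j')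
    (h h' h1 h1') : S.trg φ ψ h j h1 = S.trg φ' ψ' h' j' h1' := by
  subst hφ hψ hj
  rfl

theorem cmp_congr {φ φ' ψ ψ' : S.Shape} (hφ : φ = φ') (hψ : ψ = ψ') (h h') :
    S.cmp φ ψ h = S.cmp φ' ψ' h' := by
  subst hφ hψ
  rfl

/-- The morphism `φ^ψ` between the `j`-th fibres. -/
noncomputable def fibMor {b c d : S.Obj} (φ : b ⟶ c) (ψ : c ⟶ d) (θ : b ⟶ d) (h : φ ≫ ψ = θ)
    (j : Idx (p d)) : S.fibOb θ j ⟶ S.fibOb ψ j :=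
  ⟨S.trg φ.1 ψ.1 (S.pair_ob_eq φ ψ) j.down.val (S.idx_lt ψ j), by
    subst h
    exact S.ob_trg φ.1 ψ.1 _ _ _ _, congrArg S.ob (S.fst_trg φ.1 ψ.1 _ _ _)⟩

theorem card_fibOb {c d : S.Obj} (ψ : c ⟶ d) (j : Idx (p d)) :
    p (S.fibOb ψ j) = FinS.fib (S.cardMap ψ) j :=
  (S.card_snd _ _ _).trans (fib_congr (C := FinS.{u}) (congrArg p ψ.2.1) (congrArg p ψ.2.2)
    (S.cardMap_heq ψ).symm _ _ rfl)

theorem cardMap_fibMor {b c d : S.Obj} (φ : b ⟶ c) (ψ : c ⟶ d) (θ : b ⟶ d) (h : φ ≫ ψ = θ)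
    (h' : S.cardMap φ ≫ S.cardMap ψ = S.cardMap θ) (j : Idx (p d)) :
    S.cardMap (S.fibMor φ ψ θ h j) ≍
      FinS.fibMap (S.cardMap θ) (S.cardMap ψ) (S.cardMap φ) h' j := by
  have e1 := S.fst_pair φ.1 ψ.1 (S.pair_ob_eq φ ψ)
  refine (S.cardMap_heq _).trans ((S.arr_trg φ.1 ψ.1 (S.pair_ob_eq φ ψ) j.down.val
    (S.idx_lt ψ j) (by rw [e1]; exact S.idx_lt ψ j)).trans ?_)
  refine FinS.fibMap_congr ?_ ?_ ?_ ?_ ?_ _ h' _ _ rfl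
  · rw [ob_pair, φ.2.1]
  · rw [e1, ψ.2.1]
  · rw [e1, ψ.2.2]
  · exact (S.arr_pair _ _ _).trans (S.cardMap_heq φ).symm
  · exact (S.arr_fst_pair _ _ _).trans (S.cardMap_heq ψ).symm

/-- The functor `R_c`. -/
noncomputable def fibres (c : S.Obj) : Over c ⥤ (Idx (p c) → S.Obj) where
  obj ψ j := S.fibOb ψ.hom j
  map {θ ψ} a j := S.fibMor a.left ψ.hom θ.hom (Over.w a) j
  map_id ψ := funext fun j => Subtype.ext (S.id_trg _ _ ψ.hom.2.1 _ _ (S.idx_lt ψ.hom j) _)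
  map_comp {χ φ ψ} a b := funext fun j => Subtype.ext <| by
    have e1 : b.left ≫ ψ.hom = φ.hom := Over.w b
    have e3 := congrArg Subtype.val e1
    have h := (S.pentagon_el a.left.1 b.left.1 ψ.hom.1 (S.pair_ob_eq _ _) (S.pair_ob_eq _ _)
      (S.pair_ob_eq a.left (b.left ≫ ψ.hom)) (S.pair_ob_eq (a.left ≫ b.left) ψ.hom)).2
      j.down.val (S.idx_lt (b.left ≫ ψ.hom) j) (S.idx_lt ψ.hom j) (S.idx_lt ψ.hom j)
      (by rw [fst_trg, ob_trg])
    refine h.1.symm.trans ?_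
    exact S.cmp_congr (S.trg_congr rfl e3 rfl _ _ _ (S.idx_lt φ.hom j)) rfl _ _

noncomputable instance operadicData : OperadicData S.Obj where
  card := S.card
  R c := S.fibres c
  square c := by
    refine Functor.hext (fun ψ => funext fun j => S.card_fibOb ψ.hom j) fun θ ψ a => ?_
    refine pi_hom_heq (funext fun j => S.card_fibOb θ.hom j)
      (funext fun j => S.card_fibOb ψ.hom j) fun j => ?_
    exact S.cardMap_fibMor a.left ψ.hom θ.hom (Over.w a)
      ((S.card.map_comp a.left ψ.hom).symm.trans (congrArg S.card.map (Over.w a))) j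

/-- The elements of `C` that lie under elements of `U` are trivial objects. -/
theorem isTrivial_ob (a : S.el (unit (E := E))) (c : S.Obj) (hc : S.ob a = c) :
    IsTrivial c := by
  have h1 : (p c).len = 1 := by rw [← hc, len_ob_unit]
  refine ⟨h1, fun i => ?_⟩
  have hi : i.down.val = 0 := by
    have h2 : i.down.val < (p c).len := i.down.isLt
    omega
  have hψ : ∀ ψ : Over c, S.ob (S.fst ψ.hom.1) = S.ob a := fun ψ => ψ.hom.2.2.trans hc.symm
  have hob : ∀ ψ : Over c, S.fibOb ψ.hom i = ψ.left := fun ψ =>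
    (S.snd_ob_congr rfl hi _ (lt_of_eq_of_lt hi.symm (S.idx_lt ψ.hom i))).trans
      ((S.ob_snd_of_unit ψ.hom.1 a (hψ ψ) _).trans ψ.hom.2.1)
  refine Functor.hext hob fun θ ψ b => S.hom_heq (hob θ) (hob ψ) ?_
  exact (S.trg_congr rfl rfl hi _ (S.pair_ob_eq b.left ψ.hom) (S.idx_lt ψ.hom i)
    (lt_of_eq_of_lt hi.symm (S.idx_lt ψ.hom i))).trans
    (S.trg_unit _ _ _ a (hψ ψ) _)

theorem fib_idt (c : S.Obj) (i : Idx (p c)) (h : i.down.val < (p c).len) :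
    S.fibOb (𝟙 c) i = S.ob (S.idFib c i.down.val h) :=
  S.ob_snd_idt c _ _ _

theorem fibIncl_val {c d : S.Obj} (ψ : c ⟶ d) (j : Idx (p d)) (i : El (S.fibOb ψ j)) (hi) :
    (fibIncl ψ j i).down.val = (FinS.incl (S.arr ψ.1) ⟨⟨j.down.val, S.idx_lt ψ j⟩⟩
      ⟨⟨i.down.val, hi⟩⟩).down.val :=
  FinS.incl_congr (congrArg p ψ.2.1).symm (congrArg p ψ.2.2).symm (S.cardMap_heq ψ) _ _ rfl _ _ rfl

theorem lt_fib {c d : S.Obj} (ψ : c ⟶ d) (j : Idx (p d)) (i : El (S.fibOb ψ j)) :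
    i.down.val < (FinS.fib (S.arr ψ.1) ⟨⟨j.down.val, S.idx_lt ψ j⟩⟩).len :=
  lt_of_lt_of_eq i.down.isLt (congrArg FintypeCat.Skeleton.len (S.card_snd _ _ _))

theorem fibOb_fibMor {b c d : S.Obj} (φ : b ⟶ c) (ψ : c ⟶ d) (θ : b ⟶ d) (h : φ ≫ ψ = θ)
    (j : Idx (p d)) (i : El (S.fibOb ψ j)) :
    S.fibOb (S.fibMor φ ψ θ h j) i = S.fibOb φ (fibIncl ψ j i) :=
  S.ob_snd_trg φ.1 ψ.1 (S.pair_ob_eq φ ψ) _ (S.idx_lt ψ j) _ _ (S.lt_fib ψ j i) _ _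
    (S.fibIncl_val ψ j i _)

/-- The double slice condition holds on objects by `ob_snd_trg` and on morphisms by the last part
of `pentagon_el`. -/
noncomputable instance operadicCategory : OperadicCategory S.Obj where
  trivial_fib_id c i := by
    exact S.isTrivial_ob _ _ (S.fib_idt c i i.down.isLt).symm
  double_slice {c d} ψ j i := by
    refine Functor.hext (fun f => S.fibOb_fibMor f.hom.left ψ f.left.hom (Over.w f.hom) j i)
      fun f g a => ?_
    refine S.hom_heq (S.fibOb_fibMor f.hom.left ψ f.left.hom (Over.w f.hom) j i)
      (S.fibOb_fibMor g.hom.left ψ g.left.hom (Over.w g.hom) j i) ?_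
    have e3 : (g.hom.left ≫ ψ).1 = g.left.hom.1 := congrArg Subtype.val (Over.w g.hom)
    have h := ((S.pentagon_el a.left.left.1 g.hom.left.1 ψ.1 (S.pair_ob_eq _ _)
      (S.pair_ob_eq _ _) (S.pair_ob_eq a.left.left (g.hom.left ≫ ψ))
      (S.pair_ob_eq (a.left.left ≫ g.hom.left) ψ)).2
      j.down.val (S.idx_lt (g.hom.left ≫ ψ) j) (S.idx_lt ψ j) (S.idx_lt ψ j)
      (by rw [fst_trg, ob_trg])).2 i.down.val
      (by rw [fst_trg]; exact i.down.isLt) (S.lt_fib ψ j i) (fibIncl ψ j i).down.val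
      (S.idx_lt g.hom.left (fibIncl ψ j i)) (S.fibIncl_val ψ j i _)
    refine Eq.trans ?_ h
    exact S.trg_congr (S.trg_congr rfl e3.symm rfl _ _ (S.idx_lt g.left.hom j) _) rfl rfl _ _
      (S.idx_lt (S.fibMor g.hom.left ψ g.left.hom (Over.w g.hom) j) i) _

/-! ### The comparison with collections -/

/-- The functor `Φ`, seen as a functor to sets over the objects of the operadic category of
shapes. -/
def functor : E ⥤ Over S.Obj := S.Φ

/-- The element `(x, φ, y)` of the tensor product in `Coll` of the operadic category of shapes,
given by the shape and the components of an element of `X * Y`. -/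
noncomputable def toEl {X Y : E} (s : S.el (tens X Y)) :
    TensorEl (C := S.Obj) (S.functor.obj X) (S.functor.obj Y) where
  dom := S.ob s
  cod := S.ob (S.fst s)
  φ := ⟨S.shape s, S.ob_shape s, S.ob_fst_shape s⟩
  x := S.fst s
  hx := rfl
  y i := S.snd s i.down.val i.down.isLt
  hy _ := (S.ob_snd_shape s _ _ _).symm

theorem toEl_bijective (X Y : E) :
    Function.Bijective (S.toEl : S.el (tens X Y) → _) := by
  constructor
  · have key : ∀ {t t' : TensorEl (C := S.Obj) (S.functor.obj X) (S.functor.obj Y)}, t = t' →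
        t.φ.1 = t'.φ.1 ∧ t.x = t'.x ∧ ∀ (i : El t.cod) (j : El t'.cod),
          i.down.val = j.down.val → t.y i = t'.y j := by
      rintro t _ rfl
      refine ⟨rfl, rfl, fun i j hij => ?_⟩
      obtain rfl : i = j := ULift.ext _ _ (Fin.ext hij)
      rfl
    intro s s' h
    obtain ⟨h1, h2, h3⟩ := key h
    exact S.tens_ext h1 h2 fun n hn hn' => h3 ⟨⟨n, hn⟩⟩ ⟨⟨n, hn'⟩⟩ rfl
  · rintro ⟨c, d, φ, x, hx, y, hy⟩
    have hx : S.ob x = d := hx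
    have hl : ∀ {n}, n < (p (S.ob (S.fst φ.1))).len → n < (p d).len := fun h =>
      lt_of_lt_of_eq h (congrArg (fun c => (p c).len) φ.2.2)
    obtain ⟨s, h1, h2, h3⟩ := S.exists_tens φ.1 x (hx.trans φ.2.2.symm)
      (fun n hn => y ⟨⟨n, hl hn⟩⟩) (fun n hn => hy ⟨⟨n, hl hn⟩⟩)
    have ho : S.ob s = c := by rw [← ob_shape, h1, φ.2.1]
    have ho' : S.ob (S.fst s) = d := by rw [h2, hx]
    refine ⟨s, TensorEl.ext' ho ho' (S.hom_heq ho ho' h1) h2 fun i j hij => ?_⟩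
    have hi : i.down.val < (p (S.ob (S.fst s))).len := i.down.isLt
    refine (h3 _ hi (by rwa [← h1, ob_fst_shape])).trans ?_
    exact congrArg y (ULift.ext _ _ (Fin.ext hij))

/-- The comparison of `E` with the collections of the operadic category of shapes. -/
noncomputable def toColl : Opmonoidal E (Over S.Obj) where
  functor := S.functor
  two :=
    { app := fun XY => sliceHom (X := S.functor.obj (tens XY.1 XY.2))
        (Y := collTensorObj (S.functor.obj XY.1) (S.functor.obj XY.2)) S.toEl (fun _ => rfl)
      naturality := by
        rintro ⟨X, Y⟩ ⟨X', Y'⟩ ⟨f, g⟩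
        refine sliceHom_ext fun s => ?_
        refine TensorEl.ext' (S.ob_mp _ s) (S.ob_fst_mp f g s)
          (S.hom_heq (S.ob_mp _ s) (S.ob_fst_mp f g s) (S.shape_mp f g s)) (S.fst_mp f g s)
          fun i j hij => ?_
        have hj : j.down.val < (p (S.ob (S.fst s))).len := j.down.isLt
        exact (S.snd_mp f g s i.down.val i.down.isLt (hij.symm ▸ hj)).trans
          (congrArg (S.mp g) (S.snd_congr rfl hij (hij.symm ▸ hj) hj)) }
  zero := sliceHom (X := S.functor.obj unit) (Y := collUnit S.Obj)
    (fun a => (⟨S.ob a, S.isTrivial_ob a _ rfl⟩ : {c : S.Obj // IsTrivial c})) (fun _ => rfl)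
  two_α X Y Z := sliceHom_ext fun s => by
    obtain ⟨h1, -, h2⟩ := S.α_spec s
    have e0 : S.ob s = S.ob (S.mp (α X Y Z) s) := (S.ob_mp _ s).symm
    have e1 : S.ob (S.fst (S.fst s)) = S.ob (S.fst (S.mp (α X Y Z) s)) := congrArg S.ob h1.symm
    refine TensorEl.ext' e0 e1 (S.hom_heq e0 e1 ?_) h1.symm fun j j' hj => ?_
    · exact (S.shape_α s _ _ (S.pair_ob_eq (S.toEl s).φ (S.toEl (S.fst s)).φ) rfl rfl).symm
    obtain ⟨⟨j, hj1⟩⟩ := j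
    obtain ⟨⟨j', hj2⟩⟩ := j'
    obtain rfl : j = j' := hj
    have hj1 : j < (p (S.ob (S.fst (S.fst s)))).len := hj1
    have hj2 : j < (p (S.ob (S.fst (S.mp (α X Y Z) s)))).len := hj2
    have hs := S.pair_ob_eq (S.toEl s).φ (S.toEl (S.fst s)).φ
    obtain ⟨h3, -, h4⟩ := h2 j hj2 hj1
    have d1 : S.fibOb ((S.toEl s).φ ≫ (S.toEl (S.fst s)).φ) ⟨⟨j, hj1⟩⟩ =
        S.ob (S.snd (S.mp (α X Y Z) s) j hj2) :=
      (S.snd_ob_congr (S.shape_α s _ _ hs rfl rfl).symm rfl _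
        (by rwa [ob_fst_shape])).trans (S.ob_snd_shape _ j _ hj2)
    have d2 : S.fibOb (S.toEl (S.fst s)).φ ⟨⟨j, hj1⟩⟩ =
        S.ob (S.fst (S.snd (S.mp (α X Y Z) s) j hj2)) :=
      (S.ob_snd_shape _ j _ hj1).trans (congrArg S.ob h3.symm)
    refine TensorEl.ext' d1 d2 (S.hom_heq d1 d2 (S.shape_snd_α s _ _ hs rfl rfl j hj2
      (S.idx_lt (S.toEl (S.fst s)).φ ⟨⟨j, hj1⟩⟩)).symm)
      h3.symm fun k k' hk => ?_
    have hk' : k'.down.val < (FinS.fib (S.arr (S.fst s)) ⟨⟨j, hj1⟩⟩).len := by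
      refine lt_of_lt_of_eq k'.down.isLt (congrArg FintypeCat.Skeleton.len ?_)
      exact (congrArg (fun y => p (S.ob y)) h3).trans (S.card_snd _ _ _)
    refine (h4 k'.down.val k'.down.isLt hk' _
      (fibIncl (S.toEl (S.fst s)).φ ⟨⟨j, hj1⟩⟩ k).down.isLt ?_).symm
    refine (S.fibIncl_val (S.toEl (S.fst s)).φ ⟨⟨j, hj1⟩⟩ k (S.lt_fib _ _ k)).trans ?_
    exact FinS.incl_congr (congrArg p (S.ob_shape _)) (congrArg p (S.ob_fst_shape _))
      (S.arr_shape _) _ _ rfl _ _ hk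
  two_lam X := sliceHom_ext fun s => (S.mp_lam s (S.zero_lt (S.fst s))).symm
  two_ρ X := sliceHom_ext fun x => by
    have e0 : S.ob (S.mp (ρ X) x) = S.ob x := S.ob_mp _ x
    have e1 : S.ob (S.fst (S.mp (ρ X) x)) = S.ob x := congrArg S.ob (S.fst_ρ x)
    refine TensorEl.ext' e0 e1 (S.hom_heq e0 e1 (S.shape_ρ x _ rfl)) (S.fst_ρ x)
      fun j j' hj => Subtype.ext ?_
    have hj' : j.down.val < (p (S.ob x)).len := lt_of_eq_of_lt hj j'.down.isLt
    refine (congrArg S.ob (S.snd_ρ x _ rfl j.down.val j.down.isLt hj')).trans ?_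
    refine (S.ob_snd_idt _ _ (by rwa [ob_fst_idt]) hj').symm.trans ?_
    exact S.snd_ob_congr rfl hj _ (by rw [ob_fst_idt]; exact j'.down.isLt)

/-- The comparison lies over `Coll_𝒮`. -/
theorem toColl_comp : S.toColl.comp (OpCat.toS ⟨S.Obj⟩).coll =
    ⟨S.Φ ⋙ shriek p, S.two, S.zero, S.two_α, S.two_lam, S.two_ρ⟩ := by
  refine Opmonoidal.eq_of_heq rfl (fun X Y => ?_) ?_
  swap
  · refine heq_of_eq ?_
    refine sliceHom_ext (X := (shriek p).obj (S.Φ.obj unit)) (Y := collUnit FinS.{u}) fun a => ?_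
    exact Subtype.ext (bd_fn S.zero a).symm
  refine heq_of_eq ?_
  refine sliceHom_ext (X := (shriek p).obj (S.Φ.obj (tens X Y)))
    (Y := collTensorObj ((shriek p).obj (S.Φ.obj X)) ((shriek p).obj (S.Φ.obj Y))) fun s => ?_
  refine TensorEl.ext' (S.tr_dom s).symm (S.tr_cod s).symm ?_ rfl fun i j hij => ?_
  · exact (S.cardMap_heq _).trans ((S.arr_shape s).trans (S.arr_heq s))
  · exact S.snd_eq s _ i.down.isLt j hij.symm

theorem toColl_two_isIso (X Y : E) : IsIso (S.toColl.two.app (X, Y)) :=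
  isIso_of_bijective _ (S.toEl_bijective X Y)

/-- The map on units is bijective: a trivial object `c` is the fibre of its identity, over which
there is an element of `U`, and this element is unique by `unit_ext`. -/
theorem toColl_zero_isIso : IsIso S.toColl.zero := by
  refine isIso_of_bijective _ ⟨fun a b h => S.unit_ext a b (congrArg Subtype.val h), ?_⟩
  rintro ⟨c, hc⟩
  have hc : IsTrivial (C := S.Obj) c := hc
  have h0 : 0 < (p c).len := lt_of_lt_of_eq Nat.zero_lt_one hc.1.symm
  refine ⟨S.idFib c 0 h0, Subtype.ext ?_⟩
  exact (S.fib_idt c ⟨⟨0, h0⟩⟩ h0).symm.trans (fib_trivial hc (𝟙 c) ⟨⟨0, h0⟩⟩)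

end Presentation

/-! ### Sufficiency of the conditions -/

theorem nonempty_overIso {A B : SkewMonCat.{u, u + 1}} {Z : SkewMonCat.{u, u + 1}} (a : A ⟶ Z)
    (b : B ⟶ Z) (f : A ⟶ B) (g : B ⟶ A) (h : f ≫ g = 𝟙 A) (h' : g ≫ f = 𝟙 B) (w : f ≫ b = a) :
    Nonempty (Over.mk a ≅ Over.mk b) :=
  ⟨Over.isoMk ⟨f, g, h, h'⟩ w⟩

/-- An object satisfying the conditions is isomorphic to `Coll/1` of the operadic category of
shapes. -/
theorem essImage_of_isCollLike (P : Over (Coll.obj OpCat.S.{u})) (h : IsCollLike P) :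
    CollOver.essImage P := by
  -- Destructuring `P` turns the equality of its functor with the composite into a definitional one.
  obtain ⟨⟨E⟩, ⟨⟨⟩⟩, P⟩ := P
  obtain ⟨⟨C, p, Φ, Ψ, h1, h2, h3⟩, h4⟩ := h
  change E ⥤ Over C at Φ
  change Over C ⥤ E at Ψ
  change Φ ⋙ Ψ = 𝟭 E at h1
  change Opmonoidal E (Over FinS.{u}) at P
  change P.functor = Φ ⋙ shriek p at h3
  change NatTrans.Equifibered P.two at h4
  obtain ⟨P1, P2, P0, a1, a2, a3⟩ := P
  dsimp only at h3 h4
  subst h3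
  have ho : Φ.obj (Ψ.obj (Over.mk (𝟙 C))) = Over.mk (𝟙 C) := Functor.congr_obj h2 _
  let e := CategoryTheory.Equivalence.mk Φ Ψ (eqToIso h1.symm) (eqToIso h2)
  have full : Φ.Full := e.full_functor
  have faithful : Φ.Faithful := e.faithful_functor
  let S : Presentation E p :=
    { Φ := Φ, two := P2, zero := P0, two_α := a1, two_lam := a2, two_ρ := a3, equifibered := h4
      one := Ψ.obj (Over.mk (𝟙 C))
      isTerminal := Limits.IsTerminal.isTerminalOfObj Φ _
        (Over.mkIdTerminal.ofIso (eqToIso ho.symm))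
      one_bijective := by
        rw [ho]
        exact Function.bijective_id }
  obtain ⟨Q, q1, q2⟩ := opmonoidal_inverse S.toColl Ψ h1 h2 S.toColl_two_isIso S.toColl_zero_isIso
  obtain ⟨i⟩ := nonempty_overIso (A := ⟨E⟩) (B := Coll.obj ⟨S.Obj⟩) (Z := Coll.obj OpCat.S)
    ⟨Φ ⋙ shriek p, P2, P0, a1, a2, a3⟩ (Coll.map (OpCat.toS ⟨S.Obj⟩)) S.toColl Q q1 q2 S.toColl_comp
  exact ⟨⟨S.Obj⟩, ⟨i.symm⟩⟩

end OpCats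

theorem theorem7p1 :
    OpCats.CollOver.{u}.Full ∧ OpCats.CollOver.{u}.Faithful ∧
    (∀ P : Over (OpCats.Coll.obj OpCats.OpCat.S.{u}),
      OpCats.CollOver.essImage P ↔ OpCats.IsCollLike P) ∧
    ∃ K : OpCats.OpCat.{u} ⥤ OpCats.IsCollLike.{u}.FullSubcategory,
      K ⋙ OpCats.IsCollLike.ι = OpCats.CollOver ∧ K.IsEquivalence := by
  have full := OpCats.collOver_full.{u}
  have faithful := OpCats.collOver_faithful.{u}
  refine ⟨full, faithful, fun P => ⟨OpCats.isCollLike_of_essImage P,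
    OpCats.essImage_of_isCollLike P⟩, OpCats.IsCollLike.lift OpCats.CollOver fun C =>
      OpCats.isCollLike_of_essImage _ (OpCats.CollOver.obj_mem_essImage C), rfl, ?_⟩
  refine { faithful := inferInstance, full := inferInstance, essSurj := ⟨fun P => ?_⟩ }
  obtain ⟨C, ⟨i⟩⟩ := OpCats.essImage_of_isCollLike P.obj P.property
  exact ⟨C, ⟨OpCats.IsCollLike.isoMk i⟩⟩
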